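/- Let $X$ be a compact smooth manifold without boundary, of dimension $n$, and let $S\colon X\to\mathbb R$ be a smooth function with finitely many critical points, all of them non-degenerate (at each critical point the Hessian is a non-degenerate bilinear form). Let $\mu$ be either (a) a smooth real density on $X$, or (b) a smooth $n$-form on $X$, where $X$ is oriented. For each critical point $x_0\in\mathrm{Crit}(S)$ choose any smooth local coordinates $y^1,\dots,y^n$ around $x_0$ (in case (b), positively oriented ones), let $H_{x_0}S=\big(\partial^2 S/\partial y^i\partial y^j(x_0)\big)_{i,j}$ be the Hessian matrix of $S$ at $x_0$ in these coordinates, with signature $\operatorname{sign}H_{x_0}S$ (the number of positive minus the number of negative eigenvalues), and let $\mu_{x_0}\in\mathbb R$ be defined by $\mu(x_0)=\mu_{x_0}\,|dy^1\cdots dy^n|$ in case (a), and by $\mu(x_0)=\mu_{x_0}\,dy^1\wedge\dots\wedge dy^n$ in case (b). Then, as $\hbar\to0$ with $\hbar>0$, $$\int_X e^{\frac{\mathrm i}{\hbar}S}\,\mu=(2\pi\hbar)^{\frac n2}\sum_{x_0\in\mathrm{Crit}(S)}e^{\frac{\mathrm i}{\hbar}S(x_0)}\,\frac{e^{\frac{\mathrm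 i\pi}{4}\operatorname{sign}H_{x_0}S}}{|\det H_{x_0}S|^{1/2}}\,\mu_{x_0}+O\big(\hbar^{1+\frac n2}\big).$$ -/

import Mathlib

open scoped Manifold ContDiff Topology

noncomputable section

namespace StationaryPhase

/-- The model space `ℝⁿ`. -/
abbrev Model (n : ℕ) : Type := EuclideanSpace ℝ (Fin n)

section Charts

variable {n : ℕ} {X : Type*} [TopologicalSpace X]

/-- The matrix of second partial derivatives of `S` at `p` in the coordinates given by the
chart `e`, i.e. `∂²S / ∂yⁱ∂yʲ`. -/
def hessianMatrix (S : X → ℝ) (e : OpenPartialHomeomorph X (Model n)) (p : X) :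
    Matrix (Fin n) (Fin n) ℝ :=
  Matrix.of fun i j =>
    iteratedFDeriv ℝ 2 (S ∘ e.symm) (e p)
      ![EuclideanSpace.single i (1 : ℝ), EuclideanSpace.single j (1 : ℝ)]

/-- The signature of the quadratic form with matrix `H`: the dimension of a maximal positive
definite subspace minus the dimension of a maximal negative definite subspace. -/
def signature (H : Matrix (Fin n) (Fin n) ℝ) : ℤ :=
  (sigPos H.toQuadraticForm' : ℤ) - (sigNeg H.toQuadraticForm' : ℤ)

/-- The coordinate change from `e` to `e'` has positive Jacobian determinant wherever it is
defined. -/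
def SameOrientation (e e' : OpenPartialHomeomorph X (Model n)) : Prop :=
  ∀ x ∈ e.source ∩ e'.source, 0 < (fderiv ℝ (e' ∘ e.symm) (e x)).det

end Charts

section Manifold

variable {n : ℕ} {X : Type*} [TopologicalSpace X] [ChartedSpace (Model n) X]

/-- The set of critical points of `S`. -/
def crit (n : ℕ) {X : Type*} [TopologicalSpace X] [ChartedSpace (Model n) X] (S : X → ℝ) :
    Set X :=
  {p | mfderiv (𝓡 n) 𝓘(ℝ, ℝ) S p = 0}

/-- The Hessian of `S` at `p` is non-degenerate. For smooth `S` and critical `p` this does not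
depend on the chart in which it is tested. -/
def HasNondegenerateHessian (n : ℕ) {X : Type*} [TopologicalSpace X] [ChartedSpace (Model n) X]
    (S : X → ℝ) (p : X) : Prop :=
  ∃ e ∈ IsManifold.maximalAtlas (𝓡 n) ∞ X, p ∈ e.source ∧ (hessianMatrix S e p).det ≠ 0

/-- The coordinate tangent vectors `∂/∂y¹, …, ∂/∂yⁿ` of the chart `e`, at the point with
coordinates `y`. -/
def coordFrame (e : OpenPartialHomeomorph X (Model n)) (y : Model n) :
    Fin n → TangentSpace (𝓡 n) (e.symm y) :=
  fun i => mfderiv (𝓡 n) (𝓡 n) e.symm y (EuclideanSpace.single i (1 : ℝ) : Model n)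

variable (n X) in
/-- A smooth (real, not necessarily positive) density on `X`: at every point a function of `n`
tangent vectors that scales by `|det A|` under linear maps `A`, depending smoothly on the point. -/
structure SmoothDensity where
  toFun : ∀ x : X, (Fin n → TangentSpace (𝓡 n) x) → ℝ
  map_comp : ∀ (x : X) (A : TangentSpace (𝓡 n) x →ₗ[ℝ] TangentSpace (𝓡 n) x)
    (v : Fin n → TangentSpace (𝓡 n) x), toFun x (fun i => A (v i)) = |LinearMap.det A| * toFun x v
  smooth : ∀ e ∈ IsManifold.maximalAtlas (𝓡 n) ∞ X,
    ContDiffOn ℝ ∞ (fun y => toFun (e.symm y) (coordFrame e y)) e.target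

/-- The coefficient `ρ` of the density in the chart `e`: there the density is
`ρ(y) |dy¹ ⋯ dyⁿ|`. -/
def SmoothDensity.coeff (μ : SmoothDensity n X) (e : OpenPartialHomeomorph X (Model n))
    (y : Model n) : ℝ :=
  μ.toFun (e.symm y) (coordFrame e y)

variable (n X) in
/-- A smooth differential form of top degree on `X`. -/
structure SmoothTopForm where
  toFun : ∀ x : X, TangentSpace (𝓡 n) x [⋀^Fin n]→ₗ[ℝ] ℝ
  smooth : ∀ e ∈ IsManifold.maximalAtlas (𝓡 n) ∞ X,
    ContDiffOn ℝ ∞ (fun y => toFun (e.symm y) (coordFrame e y)) e.target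

/-- The coefficient `ρ` of the form in the chart `e`: there the form is
`ρ(y) dy¹ ∧ ⋯ ∧ dyⁿ`. -/
def SmoothTopForm.coeff (η : SmoothTopForm n X) (e : OpenPartialHomeomorph X (Model n))
    (y : Model n) : ℝ :=
  η.toFun (e.symm y) (coordFrame e y)

variable (n X) in
/-- An orientation of `X`: a maximal oriented atlas. -/
structure OrientedAtlas where
  charts : Set (OpenPartialHomeomorph X (Model n))
  subset_maximalAtlas : charts ⊆ IsManifold.maximalAtlas (𝓡 n) ∞ X
  exists_mem_source : ∀ x : X, ∃ e ∈ charts, x ∈ e.source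
  sameOrientation : ∀ e ∈ charts, ∀ e' ∈ charts, SameOrientation e e'
  maximal : ∀ e ∈ IsManifold.maximalAtlas (𝓡 n) ∞ X,
    (∀ e' ∈ charts, SameOrientation e e') → e ∈ charts

variable [T2Space X] [CompactSpace X] [IsManifold (𝓡 n) ∞ X]

/-- A smooth partition of unity on `X` subordinate to the domains of the charts `c x`. -/
def partitionOfUnity (c : X → OpenPartialHomeomorph X (Model n)) (hc : ∀ x, x ∈ (c x).source) :
    SmoothPartitionOfUnity X (𝓡 n) X Set.univ :=
  (SmoothPartitionOfUnity.exists_isSubordinate (𝓡 n) isClosed_univ (fun x => (c x).source)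
    (fun x => (c x).open_source) (fun x _ => Set.mem_iUnion.2 ⟨x, hc x⟩)).choose

theorem partitionOfUnity_isSubordinate (c : X → OpenPartialHomeomorph X (Model n))
    (hc : ∀ x, x ∈ (c x).source) :
    (partitionOfUnity c hc).IsSubordinate fun x => (c x).source :=
  (SmoothPartitionOfUnity.exists_isSubordinate (𝓡 n) isClosed_univ (fun x => (c x).source)
    (fun x => (c x).open_source) (fun x _ => Set.mem_iUnion.2 ⟨x, hc x⟩)).choose_spec

/-- The integral over `X` of `f` times the object with coefficient `ρ e` in the chart `e`:
the sum over `x` of the integrals `∫ ψₓ f ρ dy¹ ⋯ dyⁿ` in the coordinates `c x`, where `ψ` is a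
partition of unity subordinate to the domains of the charts `c x`. By compactness only finitely
many `ψₓ` are non-zero. -/
def chartIntegral (c : X → OpenPartialHomeomorph X (Model n)) (hc : ∀ x, x ∈ (c x).source)
    (ρ : OpenPartialHomeomorph X (Model n) → Model n → ℝ) (f : X → ℂ) : ℂ :=
  ∑ᶠ x : X, ∫ y in (c x).target,
    (partitionOfUnity c hc x ((c x).symm y) : ℂ) * f ((c x).symm y) * (ρ (c x) y : ℂ)

/-- The integral `∫_X f μ` of a continuous function `f` against a smooth density. -/
def SmoothDensity.integral (μ : SmoothDensity n X) (f : X → ℂ) : ℂ :=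
  chartIntegral (fun x => chartAt (Model n) x) (fun x => mem_chart_source (Model n) x) μ.coeff f

/-- The integral `∫_X f η` of a continuous function `f` against a smooth form of top degree, over
`X` with the orientation `o`. -/
def SmoothTopForm.integral (η : SmoothTopForm n X) (o : OrientedAtlas n X) (f : X → ℂ) : ℂ :=
  chartIntegral (fun x => (o.exists_mem_source x).choose)
    (fun x => (o.exists_mem_source x).choose_spec.2) η.coeff f

end Manifold

/-- The term `exp(i S(p)/ħ) · exp(iπ sign(H)/4) / |det H|^{1/2} · m` of the stationary phase
formula, where `H` is the Hessian of `S` at `p` in the chart `e`. -/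
def phaseTerm {n : ℕ} {X : Type*} [TopologicalSpace X] (S : X → ℝ)
    (e : OpenPartialHomeomorph X (Model n)) (p : X) (m ħ : ℝ) : ℂ :=
  Complex.exp (Complex.I / ħ * S p) *
    (Complex.exp (Complex.I * Real.pi / 4 * signature (hessianMatrix S e p)) /
      (Real.sqrt |(hessianMatrix S e p).det| : ℝ)) * (m : ℂ)

end StationaryPhase

end

namespace StationaryPhase

open MeasureTheory Set Filter Complex
open scoped RealInnerProductSpace

/-! Everything reduces to one nondegenerate critical point of `S` on `ℝⁿ`, placed at the origin with
`S 0 = 0`, and to `l = 1/ħ → ∞`. Neither the Morse lemma nor the Fourier transform of an imaginary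
Gaussian is used; the phase is deformed instead. The family `Φ_s = (1-s)|y|²/2 - i s S` joins a
Gaussian phase to `-iS`. Since `Re Φ_s ≥ 0`, the exponentials `e^{-lΦ_s}` stay bounded, and the
Hessian of `Φ_s` at `0` has eigenvalues `λ_j(s) = 1 - s - i s h_j`, which never vanish. Hence near
`0`, uniformly in `s ∈ [0,1]`, an amplitude vanishing at `0` has the form `∑ b_j ∂_jΦ_s`
(`exists_amplitude_division`), and integration by parts turns its integral into `1/l` times that of
`div b`. With `F(s) = ∫ χ e^{-lΦ_s}` for a fixed cutoff `χ`, iteration gives `∫ c e^{-lΦ_s} = c(0)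
F(s)` up to `O(1/l)|F(s)| + O(l^{-N})` (`exists_norm_expIntegral_sub_le`). No prior knowledge of the
size of `F(s)` is needed.

Applied to `F' = -l ∫ (∂_sΦ_s) χ e^{-lΦ_s}`, this yields `F' = -(½ ∑ λ_j'/λ_j) F` up to the same
kind of error, so `∏ λ_j^{1/2} · F` is nearly constant. Grönwall's inequality carries it from `s =
0`, an explicit Gaussian integral, to `s = 1` (`exists_norm_sqrtDet_mul_sub_le`). The principal
roots of `λ_j(1) = -i h_j` produce both `|det H|^{-1/2}` and the phase `e^{iπ sign/4}`
(`inv_sqrtDet_one`).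

Where `∇S ≠ 0`, repeated integration by parts along `∇S/|∇S|²` gives any power of `1/l`
(`exists_norm_integral_le_of_noncritical`). On `X`, a partition of unity reduces to charts. The
local term does not depend on the chart: at a critical point the Hessian changes by congruence
`JᵀHJ`, which fixes the signature, and the factor `|det J|` lost by `|det H|^{-1/2}` is restored by
the coefficient of the density, or of the form when charts are oriented
(`phaseTerm_eq_of_coeff_eq`). -/

/-- Integration over `[0, 1]` preserves smooth dependence on a parameter. -/
theorem contDiff_intervalIntegral_param {P F : Type*} [NormedAddCommGroup P] [NormedSpace ℝ P]
    [NormedAddCommGroup F] [NormedSpace ℝ F] [CompleteSpace F] {h : ℝ × P → F}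
    (hh : ContDiff ℝ ∞ h) : ContDiff ℝ ∞ (fun p => ∫ t in (0 : ℝ)..1, h (t, p)) := by
  -- The integral is the value at `0` of the convolution of the indicator of `(0, 1]` with `t ↦ κ t
  -- • h (-t, p)`. The bump `κ` is `1` on `[-1, 0]` and makes the support compact uniformly in `p`.
  let κ : ContDiffBump (0 : ℝ) := ⟨2, 3, by norm_num, by norm_num⟩
  let f : ℝ → ℝ := indicator (Ioc 0 1) 1
  let g : P → ℝ → F := fun p t => κ t • h (-t, p)
  have hf : LocallyIntegrable f volume :=
    (integrable_indicator_iff measurableSet_Ioc).2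
      (by simp [IntegrableOn, Pi.one_def]) |>.locallyIntegrable
  have hg : ContDiffOn ℝ ∞ (fun q : P × ℝ => g q.1 q.2) (univ ×ˢ univ) := by
    refine ContDiff.contDiffOn ?_
    have h1 : ContDiff ℝ ∞ fun q : P × ℝ => κ q.2 := κ.contDiff.comp contDiff_snd
    exact h1.smul (hh.comp (contDiff_snd.neg.prodMk contDiff_fst))
  have key := contDiffOn_convolution_right_with_param_comp (n := ⊤) (μ := (volume : Measure ℝ))
    (ContinuousLinearMap.lsmul ℝ ℝ) (s := univ) (v := fun _ : P => (0 : ℝ)) contDiffOn_const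
    (f := f) (g := g) (k := Metric.closedBall 0 3) isOpen_univ (isCompact_closedBall _ _)
    (fun p x _ hx => by
      have : κ x = 0 := κ.zero_of_le_dist (by simpa using le_of_lt (by simpa using hx))
      simp [g, this]) hf hg
  rw [contDiffOn_univ] at key
  convert! key using 1
  funext p
  rw [intervalIntegral.integral_of_le zero_le_one, convolution_def,
    ← integral_indicator measurableSet_Ioc]
  refine integral_congr_ae (Eventually.of_forall fun t => ?_)
  by_cases ht : t ∈ Ioc (0 : ℝ) 1
  · have : κ (-t) = 1 := κ.one_of_mem_closedBall (by
      simp only [Metric.mem_closedBall, dist_zero_right, norm_neg, Real.norm_eq_abs]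
      exact (abs_of_pos ht.1).le.trans (ht.2.trans one_le_two))
    simp [f, g, ht, this]
  · simp [f, ht]

theorem contDiff_of_tsupport {E F : Type*} [NormedAddCommGroup E] [NormedSpace ℝ E]
    [NormedAddCommGroup F] [NormedSpace ℝ F] {f : E → F}
    (h : ∀ x ∈ tsupport f, ContDiffAt ℝ ∞ f x) : ContDiff ℝ ∞ f :=
  contMDiff_iff_contDiff.1 (contMDiff_of_tsupport fun x hx => (h x hx).contMDiffAt)

/-! ### Hadamard's lemma and integration by parts. -/

section Amplitudes

variable {E : Type*} [NormedAddCommGroup E] [InnerProductSpace ℝ E]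
  {ι : Type*} [Fintype ι]

/-- Hadamard's lemma with a parameter: a smooth function vanishing on `y = 0` is a combination of
the coordinates of `y`. -/
theorem exists_eq_sum_inner_mul (u : OrthonormalBasis ι ℝ E) {f : ℝ × E → ℂ}
    (hf : ContDiff ℝ ∞ f) (h0 : ∀ s, f (s, 0) = 0) :
    ∃ g : ι → ℝ × E → ℂ, (∀ k, ContDiff ℝ ∞ (g k)) ∧
      ∀ s y, f (s, y) = ∑ k, ((⟪u k, y⟫ : ℝ) : ℂ) * g k (s, y) := by
  -- The fundamental theorem of calculus along the ray `t ↦ t • y`: the coefficient `g k` is the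
  -- average over `t ∈ [0,1]` of `∂_k f (s, t • y)`.
  let D : ι → ℝ × (ℝ × E) → ℂ := fun k q => fderiv ℝ f (q.2.1, q.1 • q.2.2) (0, u k)
  have hD : ∀ k, ContDiff ℝ ∞ (D k) := fun k => by
    have h1 : ContDiff ℝ ∞ (fderiv ℝ f) := hf.fderiv_right (by simp)
    have h2 : ContDiff ℝ ∞ fun q : ℝ × (ℝ × E) => (q.2.1, q.1 • q.2.2) := by fun_prop
    exact (h1.comp h2).clm_apply contDiff_const
  refine ⟨fun k q => ∫ t in (0 : ℝ)..1, D k (t, q), fun k =>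
    contDiff_intervalIntegral_param (hD k), fun s y => ?_⟩
  have hderiv : ∀ t : ℝ, HasDerivAt (fun t : ℝ => f (s, t • y))
      (∑ k, ((⟪u k, y⟫ : ℝ) : ℂ) * D k (t, (s, y))) t := fun t => by
    have h1 : HasFDerivAt f (fderiv ℝ f (s, t • y)) (s, t • y) :=
      (hf.differentiable (by simp)).differentiableAt.hasFDerivAt
    have h2 : HasDerivAt (fun t : ℝ => ((s, t • y) : ℝ × E)) (0, y) t :=
      (hasDerivAt_const t s).prodMk (by simpa using (hasDerivAt_id t).smul_const y)
    refine (h1.comp_hasDerivAt t h2).congr_deriv ?_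
    have h3 : ((0, y) : ℝ × E) = ∑ k, (⟪u k, y⟫ : ℝ) • ((0, u k) : ℝ × E) := by
      refine Prod.ext ?_ ?_
      · simp [Prod.fst_sum]
      · simp [Prod.snd_sum, u.sum_repr']
    rw [h3, map_sum]
    simp only [map_smul, D, Complex.real_smul]
  have hcont : ∀ k, Continuous fun t : ℝ => D k (t, (s, y)) := fun k =>
    (hD k).continuous.comp (by fun_prop)
  have hint := intervalIntegral.integral_eq_sub_of_hasDerivAt (a := 0) (b := 1)
    (fun t _ => hderiv t) (Continuous.intervalIntegrable (by fun_prop) _ _)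
  simp only [one_smul, zero_smul, h0, sub_zero] at hint
  rw [← hint, intervalIntegral.integral_finsetSum
    (fun k _ => Continuous.intervalIntegrable (by fun_prop) _ _)]
  simp

variable [FiniteDimensional ℝ E] [MeasurableSpace E] [BorelSpace E]

/-- Integration by parts against the exponential `e^{-λΨ}`. -/
theorem mul_integral_sum_fderiv_mul_cexp {κ : Type*} [Fintype κ] (u : κ → E) {Ψ : E → ℂ}
    (hΨ : ContDiff ℝ ∞ Ψ) {b : κ → E → ℂ} (hb : ∀ j, ContDiff ℝ ∞ (b j))
    (hbc : ∀ j, HasCompactSupport (b j)) (l : ℂ) :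
    l * ∫ y, (∑ j, b j y * fderiv ℝ Ψ y (u j)) * cexp (-l * Ψ y) =
      ∫ y, (∑ j, fderiv ℝ (b j) y (u j)) * cexp (-l * Ψ y) := by
  have hΨd : Differentiable ℝ Ψ := hΨ.differentiable (by simp)
  have hbd : ∀ j, Differentiable ℝ (b j) := fun j => (hb j).differentiable (by simp)
  let g : E → ℂ := fun y => cexp (-l * Ψ y)
  have hg : ContDiff ℝ ∞ g := (contDiff_const.mul hΨ).cexp
  have hΨ' : ∀ j, Continuous fun y => fderiv ℝ Ψ y (u j) := fun j =>
    (hΨ.continuous_fderiv (by simp)).clm_apply continuous_const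
  have hb' : ∀ j, Continuous fun y => fderiv ℝ (b j) y (u j) := fun j =>
    ((hb j).continuous_fderiv (by simp)).clm_apply continuous_const
  have hgd : ∀ y j, fderiv ℝ g y (u j) = -l * fderiv ℝ Ψ y (u j) * g y := fun y j => by
    have h1 : HasFDerivAt g (g y • ((-l) • fderiv ℝ Ψ y)) y :=
      ((hΨd y).hasFDerivAt.const_mul (-l)).cexp
    rw [h1.fderiv]
    simp; ring
  have i1 : ∀ j, Integrable fun y => fderiv ℝ (b j) y (u j) * g y := fun j =>
    ((hb' j).mul hg.continuous).integrable_of_hasCompactSupport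
      (((hbc j).fderiv_apply ℝ (u j)).mul_right)
  have i2 : ∀ j, Integrable fun y => b j y * fderiv ℝ Ψ y (u j) * g y := fun j =>
    (((hb j).continuous.mul (hΨ' j)).mul hg.continuous).integrable_of_hasCompactSupport
      ((hbc j).mul_right.mul_right)
  have i3 : ∀ j, Integrable fun y => b j y * g y := fun j =>
    ((hb j).continuous.mul hg.continuous).integrable_of_hasCompactSupport (hbc j).mul_right
  have hj : ∀ j, l * ∫ y, b j y * fderiv ℝ Ψ y (u j) * g y =
      ∫ y, fderiv ℝ (b j) y (u j) * g y := fun j => by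
    have h := integral_mul_fderiv_eq_neg_fderiv_mul_of_integrable (μ := (volume : Measure E))
      (f := b j) (g := g) (v := u j) (i1 j) ?_ (i3 j) (fun x _ => hbd j x)
      (fun x _ => (hg.differentiable (by simp)) x)
    · rw [← neg_eq_iff_eq_neg] at h
      rw [← h, ← integral_const_mul, ← integral_neg]
      congr 1 with y
      rw [hgd]; ring
    · refine ((i2 j).const_mul (-l)).congr (Eventually.of_forall fun y => ?_)
      simp only [hgd]; ring
  simp only [Finset.sum_mul]
  rw [integral_finsetSum _ fun j _ => i2 j, integral_finsetSum _ fun j _ => i1 j,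
    Finset.mul_sum]
  exact Finset.sum_congr rfl fun j _ => hj j

end Amplitudes

/-! ### Families of amplitudes and division by the gradient of the phase. -/

section Amplitudes

variable {E : Type*} [NormedAddCommGroup E] [InnerProductSpace ℝ E]
  {ι : Type*} [Fintype ι]

/-- Smooth families of amplitudes supported in a ball strictly smaller than that of radius `R`. -/
def IsAmplitude (R : ℝ) (c : ℝ × E → ℂ) : Prop :=
  ContDiff ℝ ∞ c ∧ ∃ r < R, ∀ s y, r ≤ ‖y‖ → c (s, y) = 0

/-- The derivative of a family of functions in the direction `v`. -/
noncomputable def dirDeriv (v : E) (c : ℝ × E → ℂ) (q : ℝ × E) : ℂ :=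
  fderiv ℝ (fun y => c (q.1, y)) q.2 v

theorem dirDeriv_eq {c : ℝ × E → ℂ} (hc : ContDiff ℝ ∞ c) (v : E) (q : ℝ × E) :
    dirDeriv v c q = fderiv ℝ c q (0, v) := by
  have h1 : HasFDerivAt c (fderiv ℝ c (q.1, q.2)) (q.1, q.2) :=
    (hc.differentiable (by simp)).differentiableAt.hasFDerivAt
  have h2 := h1.comp q.2 (hasFDerivAt_prodMk_right (𝕜 := ℝ) q.1 q.2)
  have h3 : fderiv ℝ (fun y => c (q.1, y)) q.2 = _ := h2.fderiv
  rw [dirDeriv, h3]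
  simp

theorem ContDiff.dirDeriv {c : ℝ × E → ℂ} (hc : ContDiff ℝ ∞ c) (v : E) :
    ContDiff ℝ ∞ (dirDeriv v c) := by
  have h : StationaryPhase.dirDeriv v c = fun q => fderiv ℝ c q (0, v) :=
    funext fun q => dirDeriv_eq hc v q
  rw [h]
  exact (hc.fderiv_right (by simp)).clm_apply contDiff_const

namespace IsAmplitude

variable {R : ℝ} {c c' : ℝ × E → ℂ}

theorem contDiff_slice (hc : IsAmplitude R c) (s : ℝ) : ContDiff ℝ ∞ fun y => c (s, y) :=
  hc.1.comp (contDiff_prodMk_right s)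

theorem sub (hc : IsAmplitude R c) (hc' : IsAmplitude R c') :
    IsAmplitude R (fun q => c q - c' q) := by
  obtain ⟨h, r, hr, h0⟩ := hc
  obtain ⟨h', r', hr', h0'⟩ := hc'
  refine ⟨h.sub h', max r r', max_lt hr hr', fun s y hy => ?_⟩
  simp [h0 s y ((le_max_left _ _).trans hy), h0' s y ((le_max_right _ _).trans hy)]

theorem mul_left {f : ℝ × E → ℂ} (hf : ContDiff ℝ ∞ f) (hc : IsAmplitude R c) :
    IsAmplitude R (fun q => f q * c q) := by
  obtain ⟨h, r, hr, h0⟩ := hc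
  exact ⟨hf.mul h, r, hr, fun s y hy => by simp [h0 s y hy]⟩

theorem sum {κ : Type*} [Fintype κ] (hR : 0 < R) {c : κ → ℝ × E → ℂ}
    (hc : ∀ k, IsAmplitude R (c k)) : IsAmplitude R (fun q => ∑ k, c k q) := by
  choose h r hr h0 using hc
  refine ⟨ContDiff.sum fun k _ => h k, ?_⟩
  obtain ⟨r', hr', hle⟩ : ∃ r' < R, ∀ k, r k ≤ r' := by
    rcases isEmpty_or_nonempty κ with hκ | hκ
    · exact ⟨0, hR, fun k => hκ.elim k⟩
    · exact ⟨Finset.univ.sup' Finset.univ_nonempty r, (Finset.sup'_lt_iff _).2 fun k _ => hr k,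
        fun k => Finset.le_sup' r (Finset.mem_univ k)⟩
  exact ⟨r', hr', fun s y hy => Finset.sum_eq_zero fun k _ => h0 k s y ((hle k).trans hy)⟩

theorem dirDeriv (hc : IsAmplitude R c) (v : E) : IsAmplitude R (dirDeriv v c) := by
  obtain ⟨h, r, hr, h0⟩ := hc
  -- A derivative vanishes only where the function vanishes on a neighbourhood, so the radius is
  -- enlarged slightly; the strict inequality `r < R` leaves room for this.
  obtain ⟨r', hrr', hr'⟩ := exists_between hr
  refine ⟨ContDiff.dirDeriv h v, r', hr', fun s y hy => ?_⟩
  have : (fun z => c (s, z)) =ᶠ[𝓝 y] fun _ => 0 := by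
    filter_upwards [(continuous_norm.isOpen_preimage _ isOpen_Ioi).mem_nhds
      (show ‖y‖ ∈ Ioi r from hrr'.trans_le hy)] with z hz
    exact h0 s z (le_of_lt hz)
  simp [StationaryPhase.dirDeriv, this.fderiv_eq]

theorem hasCompactSupport [FiniteDimensional ℝ E] (hc : IsAmplitude R c) (s : ℝ) :
    HasCompactSupport fun y => c (s, y) := by
  obtain ⟨h, r, hr, h0⟩ := hc
  refine HasCompactSupport.intro (isCompact_closedBall (0 : E) r) fun y hy => h0 s y ?_
  simpa using le_of_lt (by simpa using hy)

theorem exists_norm_apply_zero_le {c : ℝ × E → ℂ} (hc : IsAmplitude R c) :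
    ∃ C, 0 ≤ C ∧ ∀ s ∈ Icc (0 : ℝ) 1, ‖c (s, 0)‖ ≤ C := by
  obtain ⟨C, hC⟩ := isCompact_Icc.exists_bound_of_continuousOn (s := Icc (0 : ℝ) 1)
    (f := fun s => c (s, (0 : E))) (hc.1.continuous.comp (by fun_prop)).continuousOn
  exact ⟨C, (norm_nonneg _).trans (hC 0 (by simp)), hC⟩

end IsAmplitude

/-- The inverse of a smooth matrix function has smooth entries, after multiplication by a cutoff
supported where the matrix is invertible. -/
theorem contDiff_mul_inv_apply {F : Type*} [NormedAddCommGroup F] [NormedSpace ℝ F]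
    [DecidableEq ι] {M : F → Matrix ι ι ℂ} (hM : ∀ i j, ContDiff ℝ ∞ fun q => M q i j)
    {κ : F → ℂ} (hκ : ContDiff ℝ ∞ κ) (hdet : ∀ q ∈ tsupport κ, (M q).det ≠ 0) (i j : ι) :
    ContDiff ℝ ∞ fun q => κ q * (M q)⁻¹ i j := by
  have hdetsmooth : ∀ {A : F → Matrix ι ι ℂ}, (∀ i j, ContDiff ℝ ∞ fun q => A q i j) →
      ContDiff ℝ ∞ fun q => (A q).det := fun {A} hA => by
    simp only [Matrix.det_apply']
    exact ContDiff.sum fun σ _ => contDiff_const.mul (contDiff_prod fun i _ => hA _ _)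
  have hadj : ContDiff ℝ ∞ fun q => (M q).adjugate i j := by
    simp only [Matrix.adjugate_apply]
    refine hdetsmooth fun k l => ?_
    by_cases hk : k = j
    · subst hk; simp only [Matrix.updateRow_self]; exact contDiff_const
    · simp only [Matrix.updateRow_ne hk]; exact hM k l
  refine contDiff_of_tsupport fun q hq => ?_
  have h1 : ContDiffAt ℝ ∞ (fun q => κ q * (((M q).det)⁻¹ * (M q).adjugate i j)) q :=
    hκ.contDiffAt.mul (((hdetsmooth hM).contDiffAt.inv
      (hdet q (tsupport_mul_subset_left hq))).mul hadj.contDiffAt)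
  refine h1.congr_of_eventuallyEq (Eventually.of_forall fun q => ?_)
  simp [Matrix.inv_def, Ring.inverse_eq_inv']

/-- Division: near `y = 0` an amplitude vanishing at `y = 0` lies in the ideal generated by
functions `d j` with a common nondegenerate zero there. -/
theorem exists_amplitude_division [FiniteDimensional ℝ E] [DecidableEq ι]
    (u : OrthonormalBasis ι ℝ E) {d : ι → ℝ × E → ℂ} (hd : ∀ j, ContDiff ℝ ∞ (d j))
    (hd0 : ∀ j s, d j (s, 0) = 0) {A : ι → ℝ → ℂ} (hA : ∀ j s, A j s ≠ 0)
    (hdA : ∀ j k s, dirDeriv (u k) (d j) (s, 0) = if j = k then A j s else 0) :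
    ∃ R > 0, ∀ c : ℝ × E → ℂ, IsAmplitude R c → (∀ s, c (s, 0) = 0) →
      ∃ b : ι → ℝ × E → ℂ, (∀ j, IsAmplitude R (b j)) ∧
        ∀ s ∈ Icc (0 : ℝ) 1, ∀ y, c (s, y) = ∑ j, b j (s, y) * d j (s, y) := by
  -- Hadamard's lemma writes `d = M y` with a smooth matrix `M`, and `M (s, 0)` is the diagonal
  -- matrix of the `A j s`. Where `M` is invertible, `y = M⁻¹ d`.
  choose m hm hdm using fun j => exists_eq_sum_inner_mul u (hd j) (hd0 j)
  let M : ℝ × E → Matrix ι ι ℂ := fun q => Matrix.of fun j k => m j k q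
  have hMs : ∀ j k, ContDiff ℝ ∞ fun q => M q j k := hm
  have hM0 : ∀ s, M (s, 0) = Matrix.diagonal fun j => A j s := fun s => by
    ext j k
    rw [Matrix.diagonal_apply, ← hdA j k s, dirDeriv]
    have hder : HasFDerivAt (fun y => ∑ l, ((⟪u l, y⟫ : ℝ) : ℂ) * m j l (s, y))
        (∑ l, (((⟪u l, (0 : E)⟫ : ℝ) : ℂ) • fderiv ℝ (fun y => m j l (s, y)) 0 +
          m j l (s, 0) • (ofRealCLM.comp (innerSL ℝ (u l))))) 0 := by
      refine HasFDerivAt.fun_sum fun l _ => ?_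
      have h1 : HasFDerivAt (fun y => ((⟪u l, y⟫ : ℝ) : ℂ)) (ofRealCLM.comp (innerSL ℝ (u l)))
          (0 : E) := (ofRealCLM.comp (innerSL ℝ (u l))).hasFDerivAt
      have h2 : HasFDerivAt (fun y => m j l (s, y)) (fderiv ℝ (fun y => m j l (s, y)) 0) 0 :=
        (((hm j l).comp (contDiff_prodMk_right s)).differentiable (by simp)
          |>.differentiableAt.hasFDerivAt)
      exact h1.mul h2
    have : (fun y => d j (s, y)) = fun y => ∑ l, ((⟪u l, y⟫ : ℝ) : ℂ) * m j l (s, y) :=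
      funext fun y => hdm j s y
    simp only [this]
    rw [hder.fderiv]
    simp [orthonormal_iff_ite.1 u.orthonormal, M, apply_ite (fun x : ℝ => (x : ℂ))]
  have hdetc : Continuous fun q => (M q).det :=
    Continuous.matrix_det (continuous_matrix fun j k => (hMs j k).continuous)
  have hopen : IsOpen {q : ℝ × E | (M q).det ≠ 0} := isOpen_ne_fun hdetc continuous_const
  -- Compactness in `s` makes the radius `R` uniform. The interval `[-1, 2]` exceeds `[0, 1]` so
  -- that a smooth cutoff in `s` can equal `1` on `[0, 1]` and still live where `M` is invertible.
  obtain ⟨U, V, -, hV, hU, hV0, hUV⟩ := generalized_tube_lemma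
    (isCompact_Icc (a := (-1 : ℝ)) (b := 2)) (isCompact_singleton (x := (0 : E))) hopen (by
      rintro ⟨s, y⟩ ⟨-, hy⟩
      simp only [mem_singleton_iff] at hy
      subst hy
      simp only [mem_ofPred_eq, hM0, Matrix.det_diagonal]
      exact Finset.prod_ne_zero_iff.2 fun j _ => hA j s)
  obtain ⟨R, hR, hRV⟩ := Metric.isOpen_iff.1 hV 0 (hV0 rfl)
  refine ⟨R, hR, fun c hc hc0 => ?_⟩
  obtain ⟨e, he, hce⟩ := exists_eq_sum_inner_mul u hc.1 hc0
  obtain ⟨-, r₀, hr₀, hcr⟩ := hc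
  obtain ⟨r, hr1, hrR⟩ := exists_between (max_lt hr₀ hR)
  have hr : 0 < r := (le_max_right _ _).trans_lt hr1
  obtain ⟨r', hrr', hr'R⟩ := exists_between hrR
  let κ₁ : ContDiffBump (1 / 2 : ℝ) := ⟨1 / 2, 1, by norm_num, by norm_num⟩
  let κ₂ : ContDiffBump (0 : E) := ⟨r, r', hr, hrr'⟩
  let κ : ℝ × E → ℂ := fun q => ((κ₁ q.1 * κ₂ q.2 : ℝ) : ℂ)
  have hκ : ContDiff ℝ ∞ κ := ofRealCLM.contDiff.comp
    ((κ₁.contDiff.comp contDiff_fst).mul (κ₂.contDiff.comp contDiff_snd))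
  have hκs : tsupport κ ⊆ Metric.closedBall (1 / 2) 1 ×ˢ Metric.closedBall 0 r' := by
    refine closure_minimal ?_ (Metric.isClosed_closedBall.prod Metric.isClosed_closedBall)
    rintro ⟨s, y⟩ hq
    have hq' : κ₁ s ≠ 0 ∧ κ₂ y ≠ 0 := by simpa [κ] using hq
    have h1 : s ∈ Metric.ball (1 / 2 : ℝ) 1 := by
      rw [← κ₁.support_eq]; exact hq'.1
    have h2 : y ∈ Metric.ball (0 : E) r' := by
      rw [← κ₂.support_eq]; exact hq'.2
    exact ⟨Metric.ball_subset_closedBall h1, Metric.ball_subset_closedBall h2⟩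
  have hκdet : ∀ q ∈ tsupport κ, (M q).det ≠ 0 := fun q hq => by
    obtain ⟨h1, h2⟩ := hκs hq
    refine hUV ⟨hU ?_, hRV (Metric.closedBall_subset_ball hr'R h2)⟩
    rw [Real.closedBall_eq_Icc] at h1
    exact ⟨by linarith [h1.1], by linarith [h1.2]⟩
  -- With `c = ∑ y_k e_k`, substituting `y = M⁻¹ d` gives the coefficients `∑_k (M⁻¹)_{kj} e_k`. The
  -- cutoff `κ` makes them globally smooth and changes nothing for `s ∈ [0,1]`, because `c` vanishes
  -- where `‖y‖ ≥ r`.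
  refine ⟨fun j q => ∑ k, (κ q * (M q)⁻¹ k j) * e k q, fun j => ⟨ContDiff.sum fun k _ =>
    (contDiff_mul_inv_apply hMs hκ hκdet k j).mul (he k), r', hr'R, fun s y hy => ?_⟩,
    fun s hs y => ?_⟩
  · have : κ₂ y = 0 := κ₂.zero_of_le_dist (by simpa using hy)
    simp [κ, this]
  · have hfac : ∑ j, (∑ k, (κ (s, y) * (M (s, y))⁻¹ k j) * e k (s, y)) * d j (s, y) =
        κ (s, y) * c (s, y) := by
      by_cases hq : (M (s, y)).det = 0
      · have : κ (s, y) = 0 := by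
          by_contra h
          exact hκdet _ (subset_tsupport _ h) hq
        simp [this]
      · have hinv : ∀ k l, ∑ j, (M (s, y))⁻¹ k j * M (s, y) j l = if k = l then 1 else 0 :=
          fun k l => by
            rw [← Matrix.mul_apply, Matrix.nonsing_inv_mul _ (isUnit_iff_ne_zero.2 hq),
              Matrix.one_apply]
        calc ∑ j, (∑ k, (κ (s, y) * (M (s, y))⁻¹ k j) * e k (s, y)) * d j (s, y)
            = ∑ j, ∑ k, ∑ l, κ (s, y) * e k (s, y) * ((⟪u l, y⟫ : ℝ) : ℂ) *
                ((M (s, y))⁻¹ k j * M (s, y) j l) := by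
              refine Finset.sum_congr rfl fun j _ => ?_
              rw [hdm j s y, Finset.sum_mul_sum]
              refine Finset.sum_congr rfl fun k _ => Finset.sum_congr rfl fun l _ => ?_
              simp only [M, Matrix.of_apply]
              ring
          _ = ∑ k, ∑ l, κ (s, y) * e k (s, y) * ((⟪u l, y⟫ : ℝ) : ℂ) *
                ∑ j, ((M (s, y))⁻¹ k j * M (s, y) j l) := by
              rw [Finset.sum_comm]
              refine Finset.sum_congr rfl fun k _ => ?_
              rw [Finset.sum_comm]
              simp only [Finset.mul_sum]
          _ = κ (s, y) * c (s, y) := by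
              simp only [hinv, mul_ite, mul_one, mul_zero, Finset.sum_ite_eq, Finset.mem_univ,
                if_true]
              rw [hce s y, Finset.mul_sum]
              exact Finset.sum_congr rfl fun k _ => by ring
    rw [hfac]
    rcases le_or_gt r ‖y‖ with hy | hy
    · rw [hcr s y ((le_max_left _ _).trans (hr1.le.trans hy)), mul_zero]
    · have h1 : κ₁ s = 1 := κ₁.one_of_mem_closedBall (by
        rw [Real.closedBall_eq_Icc]
        exact ⟨by simpa [κ₁] using hs.1, by simpa [κ₁] using by linarith [hs.2]⟩)
      have h2 : κ₂ y = 1 := κ₂.one_of_mem_closedBall (by simpa using hy.le)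
      simp [κ, h1, h2]

end Amplitudes

/-- A Grönwall estimate for the increment over `[0, 1]`. -/
theorem norm_sub_le_of_norm_deriv_le {G G' : ℝ → ℂ} {κ C ε : ℝ} (hε : 0 ≤ ε) (hκ : 0 ≤ κ)
    (hκC : κ ≤ C) (hG : ∀ s ∈ Icc (0 : ℝ) 1, HasDerivAt G (G' s) s)
    (hb : ∀ s ∈ Icc (0 : ℝ) 1, ‖G' s‖ ≤ κ * ‖G s‖ + ε) :
    ‖G 1 - G 0‖ ≤ κ * (Real.exp (C + 1) * (‖G 0‖ + ε)) + ε := by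
  have hC : 0 ≤ C := hκ.trans hκC
  have h1 : ∀ s ∈ Icc (0 : ℝ) 1, ‖G s‖ ≤ Real.exp (C + 1) * (‖G 0‖ + ε) := fun s hs => by
    -- The exponential rate is `C + 1` rather than `κ`: it is nonzero, and it does not depend on
    -- `κ`, which will be `C / l`. The mean value bound at the end restores the small factor `κ`.
    have h := norm_le_gronwallBound_of_norm_deriv_right_le (f := G) (f' := G') (δ := ‖G 0‖)
      (K := C + 1) (ε := ε) (fun x hx => (hG x hx).continuousAt.continuousWithinAt)
      (fun x hx => (hG x (Ico_subset_Icc_self hx)).hasDerivWithinAt) le_rfl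
      (fun x hx => (hb x (Ico_subset_Icc_self hx)).trans (by gcongr; linarith)) s hs
    rw [gronwallBound_of_K_ne_0 (by positivity)] at h
    have h2 : Real.exp ((C + 1) * (s - 0)) ≤ Real.exp (C + 1) :=
      Real.exp_le_exp.2 (by nlinarith [hs.1, hs.2])
    have h3 : 1 ≤ Real.exp ((C + 1) * (s - 0)) :=
      Real.one_le_exp (mul_nonneg (by positivity) (by linarith [hs.1]))
    have h4 : ε / (C + 1) ≤ ε := div_le_self hε (by linarith)
    calc ‖G s‖ ≤ _ := h
      _ ≤ ‖G 0‖ * Real.exp (C + 1) + ε * Real.exp (C + 1) := by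
        have h5 : ε / (C + 1) * (Real.exp ((C + 1) * (s - 0)) - 1) ≤ ε * Real.exp (C + 1) :=
          mul_le_mul h4 (by linarith) (by linarith) hε
        have h6 := mul_le_mul_of_nonneg_left h2 (norm_nonneg (G 0))
        linarith
      _ = _ := by ring
  have := norm_image_sub_le_of_norm_deriv_le_segment_01' (f := G) (f' := G')
    (C := κ * (Real.exp (C + 1) * (‖G 0‖ + ε)) + ε)
    (fun x hx => (hG x hx).hasDerivWithinAt)
    (fun x hx => (hb x (Ico_subset_Icc_self hx)).trans
      (by gcongr; exact h1 x (Ico_subset_Icc_self hx)))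
  exact this

/-! ### Integrals against `e^{-lΦ}` depending on a parameter. -/

section Amplitudes

variable {E : Type*} [NormedAddCommGroup E] [InnerProductSpace ℝ E]
  {ι : Type*} [Fintype ι] [FiniteDimensional ℝ E] [MeasurableSpace E] [BorelSpace E]

/-- The integral `∫ c(s, y) e^{-l Φ(s, y)} dy`. -/
noncomputable def expIntegral (Φ c : ℝ × E → ℂ) (s l : ℝ) : ℂ :=
  ∫ y, c (s, y) * cexp (-(l : ℂ) * Φ (s, y))

variable {Φ : ℝ × E → ℂ} {R : ℝ}

theorem IsAmplitude.integrable (hΦ : ContDiff ℝ ∞ Φ) {c : ℝ × E → ℂ} (hc : IsAmplitude R c)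
    (s l : ℝ) : Integrable fun y => c (s, y) * cexp (-(l : ℂ) * Φ (s, y)) := by
  refine Continuous.integrable_of_hasCompactSupport ?_ (hc.hasCompactSupport s).mul_right
  have h2 : Continuous fun y => Φ (s, y) := hΦ.continuous.comp (by fun_prop)
  exact (hc.contDiff_slice s).continuous.mul (continuous_exp.comp (continuous_const.mul h2))

/-- Since `Re Φ ≥ 0`, the exponential has modulus at most `1`, and the amplitude is bounded with
support in a fixed ball. -/
theorem IsAmplitude.exists_norm_expIntegral_le {c : ℝ × E → ℂ} (hc : IsAmplitude R c)
    (hre : ∀ s ∈ Icc (0 : ℝ) 1, ∀ y, 0 ≤ (Φ (s, y)).re) :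
    ∃ C, 0 ≤ C ∧ ∀ s ∈ Icc (0 : ℝ) 1, ∀ l, 0 ≤ l → ‖expIntegral Φ c s l‖ ≤ C := by
  obtain ⟨hcs, r, hr, h0⟩ := hc
  obtain ⟨K, hK⟩ := (isCompact_Icc.prod (isCompact_closedBall (0 : E) r)).exists_bound_of_continuousOn
    (s := Icc (0 : ℝ) 1 ×ˢ Metric.closedBall (0 : E) r) (f := c) hcs.continuous.continuousOn
  have hb : ∀ s ∈ Icc (0 : ℝ) 1, ∀ l, 0 ≤ l → ‖expIntegral Φ c s l‖ ≤
      ∫ y, indicator (Metric.closedBall (0 : E) r) (fun _ => K) y := fun s hs l hl => by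
    refine norm_integral_le_of_norm_le ((integrable_indicator_iff
      Metric.isClosed_closedBall.measurableSet).2 (integrableOn_const
        (isCompact_closedBall _ _).measure_lt_top.ne)) (Eventually.of_forall fun y => ?_)
    by_cases hy : y ∈ Metric.closedBall (0 : E) r
    · rw [indicator_of_mem hy, norm_mul, Complex.norm_exp]
      have h1 : ‖c (s, y)‖ ≤ K := hK (s, y) ⟨hs, hy⟩
      have h2 : Real.exp ((-(l : ℂ) * Φ (s, y)).re) ≤ 1 := Real.exp_le_one_iff.2 (by
        have := mul_nonneg hl (hre s hs y)
        simp only [neg_mul, neg_re, re_ofReal_mul]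
        linarith)
      calc _ ≤ ‖c (s, y)‖ * 1 := by gcongr
        _ ≤ K := by linarith
    · rw [indicator_of_notMem hy, h0 s y (by simpa using le_of_lt (by simpa using hy))]
      simp
  exact ⟨_, (norm_nonneg _).trans (hb 0 (by simp) 0 le_rfl), hb⟩

/-- The reference amplitude `χ` determines the integrals of all amplitudes up to errors that are
smaller by a factor `l⁻¹`. -/
theorem exists_norm_expIntegral_sub_le (hΦ : ContDiff ℝ ∞ Φ) (hR : 0 < R)
    (hre : ∀ s ∈ Icc (0 : ℝ) 1, ∀ y, 0 ≤ (Φ (s, y)).re) (u : ι → E)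
    (hdiv : ∀ c : ℝ × E → ℂ, IsAmplitude R c → (∀ s, c (s, 0) = 0) →
      ∃ b : ι → ℝ × E → ℂ, (∀ j, IsAmplitude R (b j)) ∧
        ∀ s ∈ Icc (0 : ℝ) 1, ∀ y, c (s, y) = ∑ j, b j (s, y) * dirDeriv (u j) Φ (s, y))
    {χ : ℝ × E → ℂ} (hχ : IsAmplitude R χ) (hχ0 : ∀ s, χ (s, 0) = 1) (N : ℕ)
    {c : ℝ × E → ℂ} (hc : IsAmplitude R c) :
    ∃ C, 0 ≤ C ∧ ∀ s ∈ Icc (0 : ℝ) 1, ∀ l, 1 ≤ l →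
      ‖expIntegral Φ c s l - c (s, 0) * expIntegral Φ χ s l‖ ≤
        C / l * ‖expIntegral Φ χ s l‖ + C / l ^ N := by
  induction N generalizing c with
  | zero =>
    obtain ⟨C₁, h₁, hC₁⟩ := hc.exists_norm_expIntegral_le hre
    obtain ⟨C₂, h₂, hC₂⟩ := hχ.exists_norm_expIntegral_le hre
    obtain ⟨C₃, h₃, hC₃⟩ := hc.exists_norm_apply_zero_le
    refine ⟨C₁ + C₃ * C₂, by positivity, fun s hs l hl => ?_⟩
    have hl0 : 0 ≤ l := zero_le_one.trans hl
    calc _ ≤ ‖expIntegral Φ c s l‖ + ‖c (s, 0)‖ * ‖expIntegral Φ χ s l‖ :=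
          (norm_sub_le _ _).trans (by rw [norm_mul])
      _ ≤ C₁ + C₃ * C₂ := by
          gcongr
          · exact hC₁ s hs l hl0
          · exact hC₃ s hs
          · exact hC₂ s hs l hl0
      _ ≤ _ := by
          rw [pow_zero, div_one]
          have : 0 ≤ (C₁ + C₃ * C₂) / l * ‖expIntegral Φ χ s l‖ := by positivity
          linarith
  | succ N ih =>
    -- Subtracting `c(s,0) χ` makes the amplitude vanish at `y = 0`. Division and one integration by
    -- parts then gain a factor `l⁻¹` and leave the divergence `e`, again an amplitude, to which the
    -- induction hypothesis applies.
    have hc₀ : IsAmplitude R fun q : ℝ × E => c q - c (q.1, 0) * χ q :=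
      hc.sub (hχ.mul_left (hc.1.comp (contDiff_fst.prodMk contDiff_const)))
    obtain ⟨b, hb, hbc⟩ := hdiv _ hc₀ fun s => by simp [hχ0]
    have he := IsAmplitude.sum hR fun j => (hb j).dirDeriv (u j)
    obtain ⟨C, hC, hCe⟩ := ih he
    obtain ⟨K, hK, hKe⟩ := he.exists_norm_apply_zero_le
    set e : ℝ × E → ℂ := fun q => ∑ j, dirDeriv (u j) (b j) q with hedef
    refine ⟨K + C, by positivity, fun s hs l hl => ?_⟩
    have hl0 : 0 < l := zero_lt_one.trans_le hl
    have hlin : expIntegral Φ c s l - c (s, 0) * expIntegral Φ χ s l =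
        ∫ y, (c (s, y) - c (s, 0) * χ (s, y)) * cexp (-(l : ℂ) * Φ (s, y)) := by
      rw [expIntegral, expIntegral, ← integral_const_mul,
        ← integral_sub (hc.integrable hΦ s l) ((hχ.integrable hΦ s l).const_mul _)]
      congr 1 with y
      ring
    have hparts : (l : ℂ) * (expIntegral Φ c s l - c (s, 0) * expIntegral Φ χ s l) =
        expIntegral Φ e s l := by
      have h := mul_integral_sum_fderiv_mul_cexp u (Ψ := fun y => Φ (s, y))
        (hΦ.comp (contDiff_prodMk_right s)) (fun j => (hb j).contDiff_slice s)
        (fun j => (hb j).hasCompactSupport s) l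
      rw [hlin, expIntegral]
      refine Eq.trans ?_ h
      congr 2 with y
      rw [hbc s hs y]
      rfl
    have hnorm : l * ‖expIntegral Φ c s l - c (s, 0) * expIntegral Φ χ s l‖ ≤
        (K + C) * ‖expIntegral Φ χ s l‖ + (K + C) / l ^ N := by
      have hl' : ‖(l : ℂ)‖ = l := by rw [Complex.norm_real, Real.norm_eq_abs, abs_of_pos hl0]
      have hn := congrArg norm hparts
      rw [norm_mul, hl'] at hn
      rw [hn]
      calc ‖expIntegral Φ e s l‖ = ‖(expIntegral Φ e s l - e (s, 0) * expIntegral Φ χ s l) +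
            e (s, 0) * expIntegral Φ χ s l‖ := by rw [sub_add_cancel]
        _ ≤ (C / l * ‖expIntegral Φ χ s l‖ + C / l ^ N) + K * ‖expIntegral Φ χ s l‖ := by
            refine (norm_add_le _ _).trans ?_
            rw [norm_mul]
            gcongr
            · exact hCe s hs l hl
            · exact hKe s hs
        _ ≤ (C * ‖expIntegral Φ χ s l‖ + (K + C) / l ^ N) + K * ‖expIntegral Φ χ s l‖ := by
            gcongr
            · exact div_le_self hC hl
            · linarith
        _ = _ := by ring
    rw [← le_div_iff₀' hl0] at hnorm
    refine hnorm.trans (le_of_eq ?_)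
    rw [pow_succ]
    field_simp

/-- Differentiation of `∫ χ e^{-lΦ}` with respect to the parameter. -/
theorem hasDerivAt_expIntegral (hΦ : ContDiff ℝ ∞ Φ) {Φ' : ℝ × E → ℂ} (hΦ' : Continuous Φ')
    (hd : ∀ s y, HasDerivAt (fun s => Φ (s, y)) (Φ' (s, y)) s) {χ : E → ℂ}
    (hχ : IsAmplitude R fun q : ℝ × E => χ q.2) (s l : ℝ) :
    HasDerivAt (fun s => expIntegral Φ (fun q => χ q.2) s l)
      (-(l : ℂ) * expIntegral Φ (fun q => Φ' q * χ q.2) s l) s := by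
  obtain ⟨hcs, r, hr, h0⟩ := id hχ
  have hχc : Continuous χ := (hχ.contDiff_slice 0).continuous
  let F : ℝ → E → ℂ := fun s y => χ y * cexp (-(l : ℂ) * Φ (s, y))
  let F' : ℝ → E → ℂ := fun s y => -(l : ℂ) * (Φ' (s, y) * χ y * cexp (-(l : ℂ) * Φ (s, y)))
  have hF'c : Continuous fun q : ℝ × E => F' q.1 q.2 := by
    have := hΦ.continuous
    simp only [F']
    fun_prop
  obtain ⟨K, hK⟩ := ((isCompact_closedBall s 1).prod
    (isCompact_closedBall (0 : E) r)).exists_bound_of_continuousOn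
    (f := fun q : ℝ × E => F' q.1 q.2) hF'c.continuousOn
  have h := hasDerivAt_integral_of_dominated_loc_of_deriv_le (μ := (volume : Measure E))
    (F := F) (F' := F') (x₀ := s) (s := Metric.closedBall s 1)
    (bound := indicator (Metric.closedBall (0 : E) r) (fun _ => K))
    (Metric.closedBall_mem_nhds s one_pos)
    (Eventually.of_forall fun t => (hχ.integrable hΦ t l).aestronglyMeasurable)
    (hχ.integrable hΦ s l)
    (hF'c.comp (Continuous.prodMk_right s)).aestronglyMeasurable
    (Eventually.of_forall fun y t ht => ?_)
    ((integrable_indicator_iff Metric.isClosed_closedBall.measurableSet).2 (integrableOn_const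
        (isCompact_closedBall _ _).measure_lt_top.ne))
    (Eventually.of_forall fun y t _ => ?_)
  · refine h.2.congr_deriv ?_
    simp only [F', expIntegral]
    rw [integral_const_mul]
  · by_cases hy : y ∈ Metric.closedBall (0 : E) r
    · rw [indicator_of_mem hy]
      exact hK (t, y) ⟨ht, hy⟩
    · have : χ y = 0 := h0 t y (by simpa using le_of_lt (by simpa using hy))
      simp [F', this, indicator_of_notMem hy]
  · refine ((((hd t y).const_mul (-(l : ℂ))).cexp).const_mul (χ y)).congr_deriv ?_
    simp only [F']
    ring

end Amplitudes

/-! ### Comparison of Taylor coefficients, and exponential against polynomial decay. -/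

/-- If `∑ β γ` has leading term `a t²`, where all `γ j` vanish at `0` and only `γ k` to first
order, then `β k` vanishes at `0`. -/
theorem apply_zero_eq_zero_of_tendsto {ι : Type*} [Fintype ι] [DecidableEq ι] {β γ : ι → ℝ → ℂ}
    {A : ℂ} (hA : A ≠ 0) (k : ι) (hβ : ∀ j, ContinuousAt (β j) 0) (hγ0 : ∀ j, γ j 0 = 0)
    (hγ : ∀ j, HasDerivAt (γ j) (if j = k then A else 0) 0) {a : ℂ}
    (ha : Tendsto (fun t : ℝ => (∑ j, β j t * γ j t) / (t : ℂ) ^ 2) (𝓝[≠] 0) (𝓝 a)) :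
    β k 0 = 0 := by
  have hγt : ∀ j, Tendsto (fun t : ℝ => γ j t / (t : ℂ)) (𝓝[≠] 0)
      (𝓝 (if j = k then A else 0)) := fun j => by
    refine (hasDerivAt_iff_tendsto_slope_zero.1 (hγ j)).congr fun t => ?_
    simp [hγ0, div_eq_inv_mul]
  -- Divided by `t`, the sum tends to `β k 0 * A`; being also `t` times a convergent quantity, it
  -- tends to `0`.
  have h1 : Tendsto (fun t : ℝ => ∑ j, β j t * (γ j t / (t : ℂ))) (𝓝[≠] 0)
      (𝓝 (∑ j, β j 0 * (if j = k then A else 0))) :=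
    tendsto_finsetSum _ fun j _ => ((hβ j).tendsto.mono_left nhdsWithin_le_nhds).mul (hγt j)
  have ht : Tendsto (fun t : ℝ => (t : ℂ)) (𝓝[≠] 0) (𝓝 0) := by
    have : Tendsto (fun t : ℝ => (t : ℂ)) (𝓝 0) (𝓝 ((0 : ℝ) : ℂ)) :=
      continuous_ofReal.tendsto 0
    simpa using this.mono_left nhdsWithin_le_nhds
  have h2 := ht.mul ha
  have h3 := tendsto_nhds_unique (h1.congr' ?_) h2
  · simpa [hA] using h3
  · filter_upwards [self_mem_nhdsWithin] with t (ht : t ≠ 0)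
    rw [Finset.sum_div, Finset.mul_sum]
    refine Finset.sum_congr rfl fun j _ => ?_
    have : (t : ℂ) ≠ 0 := ofReal_ne_zero.2 ht
    field_simp

/-- The quotient by `t²` splits into products of two slopes, and only the `k`-th slope of `γ`
survives. This reads `∂_k b_k` at the critical point off a second order Taylor coefficient, although
the `b_k` come from a non-unique division. -/
theorem deriv_eq_div_of_tendsto {ι : Type*} [Fintype ι] [DecidableEq ι] {β γ : ι → ℝ → ℂ}
    {A : ℂ} (hA : A ≠ 0) (k : ι) {β' : ι → ℂ} (hβ : ∀ j, HasDerivAt (β j) (β' j) 0)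
    (hβ0 : ∀ j, β j 0 = 0) (hγ0 : ∀ j, γ j 0 = 0)
    (hγ : ∀ j, HasDerivAt (γ j) (if j = k then A else 0) 0) {a : ℂ}
    (ha : Tendsto (fun t : ℝ => (∑ j, β j t * γ j t) / (t : ℂ) ^ 2) (𝓝[≠] 0) (𝓝 a)) :
    β' k = a / A := by
  have hγt : ∀ j, Tendsto (fun t : ℝ => γ j t / (t : ℂ)) (𝓝[≠] 0)
      (𝓝 (if j = k then A else 0)) := fun j => by
    refine (hasDerivAt_iff_tendsto_slope_zero.1 (hγ j)).congr fun t => ?_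
    simp [hγ0, div_eq_inv_mul]
  have hβt : ∀ j, Tendsto (fun t : ℝ => β j t / (t : ℂ)) (𝓝[≠] 0) (𝓝 (β' j)) := fun j => by
    refine (hasDerivAt_iff_tendsto_slope_zero.1 (hβ j)).congr fun t => ?_
    simp [hβ0, div_eq_inv_mul]
  have h1 : Tendsto (fun t : ℝ => ∑ j, (β j t / (t : ℂ)) * (γ j t / (t : ℂ))) (𝓝[≠] 0)
      (𝓝 (∑ j, β' j * (if j = k then A else 0))) :=
    tendsto_finsetSum _ fun j _ => (hβt j).mul (hγt j)
  have h3 := tendsto_nhds_unique (h1.congr' ?_) ha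
  · rw [eq_div_iff hA]
    simpa using h3
  · filter_upwards [self_mem_nhdsWithin] with t (ht : t ≠ 0)
    rw [Finset.sum_div]
    refine Finset.sum_congr rfl fun j _ => ?_
    have : (t : ℂ) ≠ 0 := ofReal_ne_zero.2 ht
    field_simp

theorem exists_exp_le_div_pow {a : ℝ} (ha : 0 < a) (N : ℕ) :
    ∃ C, 0 ≤ C ∧ ∀ l : ℝ, 1 ≤ l → Real.exp (-(l - 1) * a) ≤ C / l ^ N := by
  refine ⟨Real.exp a * N.factorial / a ^ N, by positivity, fun l hl => ?_⟩
  have hl0 : 0 < l := zero_lt_one.trans_le hl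
  have h := Real.pow_div_factorial_le_exp (l * a) (by positivity) N
  have h1 : Real.exp (-(l - 1) * a) = Real.exp a / Real.exp (l * a) := by
    rw [← Real.exp_sub]; congr 1; ring
  rw [h1, div_div, div_le_div_iff₀ (Real.exp_pos _) (by positivity)]
  rw [div_le_iff₀ (by positivity), mul_pow] at h
  calc Real.exp a * (a ^ N * l ^ N) ≤ Real.exp a * (Real.exp (l * a) * N.factorial) := by
        gcongr ?_ * ?_; linarith
    _ = _ := by ring

/-! ### The homotopy of phases and its Gaussian endpoint. -/

section Phase

variable {E : Type*} [NormedAddCommGroup E] [InnerProductSpace ℝ E]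
  {ι : Type*} [Fintype ι]

/-- The second order Taylor coefficient along a line. -/
theorem tendsto_div_sq {S : E → ℝ} (hS : ContDiff ℝ ∞ S) (hS0 : S 0 = 0)
    (hdS : fderiv ℝ S 0 = 0) (v : E) :
    Tendsto (fun t : ℝ => S (t • v) / t ^ 2) (𝓝[≠] 0)
      (𝓝 (fderiv ℝ (fderiv ℝ S) 0 v v / 2)) := by
  have hline : ∀ t : ℝ, HasDerivAt (fun t : ℝ => t • v) v t := fun t => by
    simpa using (hasDerivAt_id t).smul_const v
  have h1 : ∀ t : ℝ, HasDerivAt (fun t : ℝ => S (t • v)) (fderiv ℝ S (t • v) v) t := fun t =>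
    (hS.differentiable (by simp)).differentiableAt.hasFDerivAt.comp_hasDerivAt t (hline t)
  have h2 : HasDerivAt (fun t : ℝ => fderiv ℝ S (t • v) v) (fderiv ℝ (fderiv ℝ S) 0 v v) 0 := by
    have hd : HasFDerivAt (fderiv ℝ S) (fderiv ℝ (fderiv ℝ S) 0) 0 :=
      ((hS.fderiv_right (m := ∞) (by simp)).differentiable (by simp)).differentiableAt.hasFDerivAt
    have h3 := hd.comp_hasDerivAt_of_eq (0 : ℝ) (hline 0) (zero_smul ℝ v).symm
    exact (ContinuousLinearMap.apply ℝ ℝ v).hasFDerivAt.comp_hasDerivAt (0 : ℝ) h3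
  refine HasDerivAt.lhopital_zero_nhdsNE (f' := fun t => fderiv ℝ S (t • v) v)
    (g' := fun t => 2 * t) (Eventually.of_forall h1) (Eventually.of_forall fun t => by
      simpa using hasDerivAt_pow 2 t) ?_ ?_ ?_ ?_
  · filter_upwards [self_mem_nhdsWithin] with t (ht : t ≠ 0)
    simpa using ht
  · have := (h1 0).continuousAt.tendsto.mono_left (nhdsWithin_le_nhds (s := {0}ᶜ))
    simpa [hS0] using this
  · have : Tendsto (fun t : ℝ => t ^ 2) (𝓝 0) (𝓝 (0 ^ 2)) := (continuous_pow 2).tendsto 0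
    simpa using this.mono_left (nhdsWithin_le_nhds (s := {0}ᶜ))
  · refine ((hasDerivAt_iff_tendsto_slope_zero.1 h2).div_const 2).congr fun t => ?_
    simp [hdS]
    ring

/-- The homotopy from the Gaussian phase `‖y‖²/2` to `-iS`. -/
noncomputable def gaussianHomotopy (S : E → ℝ) (q : ℝ × E) : ℂ :=
  (((1 - q.1) * (‖q.2‖ ^ 2 / 2) : ℝ) : ℂ) - I * ((q.1 * S q.2 : ℝ) : ℂ)

theorem contDiff_gaussianHomotopy {S : E → ℝ} (hS : ContDiff ℝ ∞ S) :
    ContDiff ℝ ∞ (gaussianHomotopy S) := by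
  have h1 : ContDiff ℝ ∞ fun q : ℝ × E => (1 - q.1) * (‖q.2‖ ^ 2 / 2) :=
    (contDiff_const.sub contDiff_fst).mul (((contDiff_norm_sq ℝ).comp contDiff_snd).div_const 2)
  have h2 : ContDiff ℝ ∞ fun q : ℝ × E => q.1 * S q.2 :=
    contDiff_fst.mul (hS.comp contDiff_snd)
  exact (ofRealCLM.contDiff.comp h1).sub (contDiff_const.mul (ofRealCLM.contDiff.comp h2))

theorem dirDeriv_gaussianHomotopy {S : E → ℝ} (hS : ContDiff ℝ ∞ S) (v : E) (q : ℝ × E) :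
    dirDeriv v (gaussianHomotopy S) q =
      (((1 - q.1) * ⟪v, q.2⟫ : ℝ) : ℂ) - I * ((q.1 * fderiv ℝ S q.2 v : ℝ) : ℂ) := by
  have h1 : HasFDerivAt (fun y : E => (1 - q.1) * (‖y‖ ^ 2 / 2))
      ((1 - q.1) • innerSL ℝ q.2) q.2 := by
    have := ((hasStrictFDerivAt_norm_sq q.2).hasFDerivAt.mul_const (1 / 2 : ℝ)).const_mul (1 - q.1)
    convert! this using 1
    · ext y; ring
    · ext y; simp
  have h2 : HasFDerivAt (fun y : E => q.1 * S y) (q.1 • fderiv ℝ S q.2) q.2 :=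
    (hS.differentiable (by simp)).differentiableAt.hasFDerivAt.const_mul q.1
  have h3 := (ofRealCLM.hasFDerivAt.comp q.2 h1).sub
    ((ofRealCLM.hasFDerivAt.comp q.2 h2).const_mul I)
  have h4 : fderiv ℝ (fun y => gaussianHomotopy S (q.1, y)) q.2 = _ := h3.fderiv
  rw [dirDeriv, h4]
  simp [real_inner_comm]

theorem hasDerivAt_gaussianHomotopy {E : Type*} [NormedAddCommGroup E] (S : E → ℝ) (s : ℝ) (y : E) :
    HasDerivAt (fun s => gaussianHomotopy S (s, y)) (-((‖y‖ ^ 2 / 2 : ℝ) : ℂ) - I * S y) s := by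
  have h1 : HasDerivAt (fun s : ℝ => (1 - s) * (‖y‖ ^ 2 / 2)) (-(‖y‖ ^ 2 / 2)) s := by
    simpa using ((hasDerivAt_id s).const_sub 1).mul_const (‖y‖ ^ 2 / 2)
  have h2 : HasDerivAt (fun s : ℝ => s * S y) (S y) s := by
    simpa using (hasDerivAt_id s).mul_const (S y)
  rw [← ofReal_neg]
  exact h1.ofReal_comp.fun_sub (h2.ofReal_comp.const_mul I)

variable [FiniteDimensional ℝ E] [MeasurableSpace E] [BorelSpace E]

/-- The cutoff matters only where `‖y‖ > r`. There `e^{-l|y|²/2} ≤ e^{-(l-1)r²/2} e^{-|y|²/2}`, an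
integrable function times an exponentially small constant. -/
theorem exists_norm_integral_gaussian_sub_le {χ : E → ℝ} (hχc : Continuous χ)
    {r : ℝ} (hr : 0 < r) (h1 : ∀ y, ‖y‖ ≤ r → χ y = 1) (h01 : ∀ y, χ y ∈ Icc (0 : ℝ) 1) (N : ℕ) :
    ∃ C, 0 ≤ C ∧ ∀ l : ℝ, 1 ≤ l →
      ‖(∫ y, (χ y : ℂ) * ((Real.exp (-(l / 2) * ‖y‖ ^ 2) : ℝ) : ℂ)) -
        (((2 * Real.pi / l) ^ ((Module.finrank ℝ E : ℝ) / 2) : ℝ) : ℂ)‖ ≤ C / l ^ N := by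
  have hint : ∀ l : ℝ, 0 < l → Integrable fun y : E => Real.exp (-(l / 2) * ‖y‖ ^ 2) :=
    fun l hl => by
      have := (GaussianFourier.integrable_cexp_neg_mul_sq_norm_add (b := ((l / 2 : ℝ) : ℂ))
        (by simpa using hl) 0 (0 : E)).re
      refine this.congr (Eventually.of_forall fun y => ?_)
      simp only [zero_mul, add_zero, RCLike.re_to_complex]
      rw [← ofReal_neg, ← ofReal_pow, ← ofReal_mul, exp_ofReal_re]
  obtain ⟨C, hC, hCe⟩ := exists_exp_le_div_pow (a := r ^ 2 / 2) (by positivity) N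
  set K := ∫ y : E, Real.exp (-(1 / 2) * ‖y‖ ^ 2) with hK
  have hK0 : 0 ≤ K := integral_nonneg fun y => (Real.exp_pos _).le
  refine ⟨C * K, by positivity, fun l hl => ?_⟩
  have hl0 : 0 < l := zero_lt_one.trans_le hl
  have hχint : Integrable fun y : E => χ y * Real.exp (-(l / 2) * ‖y‖ ^ 2) := by
    refine (hint l hl0).bdd_mul (c := 1) hχc.aestronglyMeasurable (Eventually.of_forall fun y => ?_)
    rw [Real.norm_eq_abs, abs_of_nonneg (h01 y).1]
    exact (h01 y).2
  have hgauss : (2 * Real.pi / l) ^ ((Module.finrank ℝ E : ℝ) / 2) =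
      ∫ y : E, Real.exp (-(l / 2) * ‖y‖ ^ 2) := by
    rw [GaussianFourier.integral_rexp_neg_mul_sq_norm (by positivity)]
    congr 1
    field_simp
  simp only [← ofReal_mul]
  rw [integral_complex_ofReal, ← ofReal_sub, Complex.norm_real, hgauss, ← integral_sub hχint (hint l hl0)]
  calc _ ≤ ∫ y : E, Real.exp (-(l - 1) * (r ^ 2 / 2)) * Real.exp (-(1 / 2) * ‖y‖ ^ 2) := by
        refine norm_integral_le_of_norm_le ((hint 1 one_pos).const_mul _)
          (Eventually.of_forall fun y => ?_)
        rcases le_or_gt ‖y‖ r with hy | hy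
        · rw [h1 y hy]
          simp only [one_mul, sub_self, norm_zero]
          positivity
        · have h2 : χ y * Real.exp (-(l / 2) * ‖y‖ ^ 2) - Real.exp (-(l / 2) * ‖y‖ ^ 2) =
              -((1 - χ y) * Real.exp (-(l / 2) * ‖y‖ ^ 2)) := by ring
          rw [h2, norm_neg, norm_mul, Real.norm_eq_abs, Real.norm_eq_abs, Real.abs_exp,
            abs_of_nonneg (by linarith [(h01 y).2]), ← Real.exp_add]
          have h3 : Real.exp (-(l / 2) * ‖y‖ ^ 2) ≤
              Real.exp (-(l - 1) * (r ^ 2 / 2) + -(1 / 2) * ‖y‖ ^ 2) := by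
            refine Real.exp_le_exp.2 ?_
            have : r ^ 2 ≤ ‖y‖ ^ 2 := by gcongr
            nlinarith
          calc _ ≤ 1 * Real.exp (-(l / 2) * ‖y‖ ^ 2) := by
                gcongr; linarith [(h01 y).1]
            _ ≤ _ := by rw [one_mul]; exact h3
    _ = Real.exp (-(l - 1) * (r ^ 2 / 2)) * K := integral_const_mul _ _
    _ ≤ C / l ^ N * K := by gcongr; exact hCe l hl
    _ = _ := by ring

end Phase

/-! ### The Hessian determinant along the homotopy and the transport of the integral. -/

section Local

variable {ι : Type*} [Fintype ι]

/-- The eigenvalues `1 - s - i s h j` of the Hessian along the homotopy. -/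
noncomputable def homotopyEigenvalue (h : ι → ℝ) (j : ι) (s : ℝ) : ℂ :=
  ((1 - s : ℝ) : ℂ) - I * ((s * h j : ℝ) : ℂ)

theorem homotopyEigenvalue_re {ι : Type*} (h : ι → ℝ) (j : ι) (s : ℝ) :
    (homotopyEigenvalue h j s).re = 1 - s := by simp [homotopyEigenvalue]

theorem homotopyEigenvalue_im {ι : Type*} (h : ι → ℝ) (j : ι) (s : ℝ) :
    (homotopyEigenvalue h j s).im = -(s * h j) := by simp [homotopyEigenvalue]

theorem homotopyEigenvalue_ne_zero {ι : Type*} {h : ι → ℝ} (hne : ∀ j, h j ≠ 0) (j : ι) (s : ℝ) :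
    homotopyEigenvalue h j s ≠ 0 := fun h0 => by
  have h1 := congrArg re h0
  have h2 := congrArg im h0
  rw [homotopyEigenvalue_re, zero_re] at h1
  rw [homotopyEigenvalue_im, zero_im, neg_eq_zero, mul_eq_zero] at h2
  rcases h2 with h2 | h2
  · linarith
  · exact hne j h2

/-- The real part `1 - s` is positive until `s = 1`, where the value is `-i h_j ≠ 0`. The principal
logarithm is therefore smooth along the whole path and fixes the branch of the square root. -/
theorem homotopyEigenvalue_mem_slitPlane {ι : Type*} {h : ι → ℝ} (hne : ∀ j, h j ≠ 0) (j : ι) {s : ℝ}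
    (hs : s ∈ Icc (0 : ℝ) 1) : homotopyEigenvalue h j s ∈ slitPlane := by
  rw [mem_slitPlane_iff, homotopyEigenvalue_re, homotopyEigenvalue_im]
  rcases hs.2.lt_or_eq with h1 | h1
  · left; linarith
  · right; simp [h1, hne j]

/-- The square root of the determinant of the Hessian along the homotopy. -/
noncomputable def sqrtDet (h : ι → ℝ) (s : ℝ) : ℂ :=
  cexp (∑ j, log (homotopyEigenvalue h j s) / 2)

theorem hasDerivAt_sqrtDet {h : ι → ℝ} (hne : ∀ j, h j ≠ 0) {s : ℝ} (hs : s ∈ Icc (0 : ℝ) 1) :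
    HasDerivAt (sqrtDet h)
      ((∑ j, (-(1 / 2) - I * (h j / 2)) / homotopyEigenvalue h j s) * sqrtDet h s) s := by
  have h1 : ∀ j, HasDerivAt (homotopyEigenvalue h j) (-1 - I * h j) s := fun j => by
    have h1 : HasDerivAt (fun s : ℝ => 1 - s) (-1) s := by
      simpa using (hasDerivAt_id s).const_sub 1
    have h2 : HasDerivAt (fun s : ℝ => s * h j) (h j) s := by
      simpa using (hasDerivAt_id s).mul_const (h j)
    have h3 := h1.ofReal_comp.fun_sub (h2.ofReal_comp.const_mul I)
    rw [ofReal_neg, ofReal_one] at h3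
    exact h3
  have h2 : HasDerivAt (fun s => ∑ j, log (homotopyEigenvalue h j s) / 2)
      (∑ j, (-(1 / 2) - I * (h j / 2)) / homotopyEigenvalue h j s) s := by
    refine HasDerivAt.fun_sum fun j _ => ?_
    refine (((h1 j).clog_real (homotopyEigenvalue_mem_slitPlane hne j hs)).div_const 2).congr_deriv ?_
    have := homotopyEigenvalue_ne_zero hne j s
    field_simp
  exact h2.cexp.congr_deriv (mul_comm _ _)

theorem sqrtDet_zero (h : ι → ℝ) : sqrtDet h 0 = 1 := by
  simp [sqrtDet, homotopyEigenvalue]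

variable {E : Type*} [NormedAddCommGroup E] [InnerProductSpace ℝ E] [DecidableEq ι]

theorem gaussianHomotopy_re {E : Type*} [NormedAddCommGroup E] {S : E → ℝ} (s : ℝ) (hs : s ∈ Icc (0 : ℝ) 1) (y : E) :
    0 ≤ (gaussianHomotopy S (s, y)).re := by
  have : (gaussianHomotopy S (s, y)).re = (1 - s) * (‖y‖ ^ 2 / 2) := by
    simp only [gaussianHomotopy, sub_re, ofReal_re, I_mul_re, ofReal_im, neg_zero, sub_zero]
  rw [this]
  exact mul_nonneg (by linarith [hs.2]) (by positivity)

/-- An orthonormal eigenbasis of the Hessian of `S` diagonalises the Hessians of all phases of the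
homotopy at once. -/
theorem dirDeriv_dirDeriv_gaussianHomotopy {S : E → ℝ} (hS : ContDiff ℝ ∞ S)
    (u : OrthonormalBasis ι ℝ E) {h : ι → ℝ}
    (hH : ∀ j k, fderiv ℝ (fderiv ℝ S) 0 (u j) (u k) = if j = k then h j else 0) (j k : ι) (s : ℝ) :
    dirDeriv (u k) (dirDeriv (u j) (gaussianHomotopy S)) (s, 0) =
      if j = k then homotopyEigenvalue h j s else 0 := by
  have h1 : HasFDerivAt (fun y : E => (1 - s) * ⟪u j, y⟫) ((1 - s) • innerSL ℝ (u j)) 0 :=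
    (innerSL ℝ (u j)).hasFDerivAt.const_mul (1 - s)
  have hd : HasFDerivAt (fderiv ℝ S) (fderiv ℝ (fderiv ℝ S) 0) 0 :=
    ((hS.fderiv_right (m := ∞) (by simp)).differentiable (by simp)).differentiableAt.hasFDerivAt
  have h2 : HasFDerivAt (fun y : E => s * fderiv ℝ S y (u j))
      (s • (ContinuousLinearMap.apply ℝ ℝ (u j)).comp (fderiv ℝ (fderiv ℝ S) 0)) 0 :=
    ((ContinuousLinearMap.apply ℝ ℝ (u j)).hasFDerivAt.comp (0 : E) hd).const_mul s
  have h3 := (ofRealCLM.hasFDerivAt.comp (0 : E) h1).sub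
    ((ofRealCLM.hasFDerivAt.comp (0 : E) h2).const_mul I)
  have h4 : (fun y => dirDeriv (u j) (gaussianHomotopy S) (s, y)) = fun y =>
      (((1 - s) * ⟪u j, y⟫ : ℝ) : ℂ) - I * ((s * fderiv ℝ S y (u j) : ℝ) : ℂ) :=
    funext fun y => dirDeriv_gaussianHomotopy hS (u j) (s, y)
  have h5 := h3.congr_of_eventuallyEq (EventuallyEq.of_eq h4)
  rw [dirDeriv, h5.fderiv]
  simp only [sub_apply, ContinuousLinearMap.comp_apply,
    smul_apply, ofRealCLM_apply, innerSL_apply_apply, hH,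
    ContinuousLinearMap.apply_apply, orthonormal_iff_ite.1 u.orthonormal, smul_eq_mul]
  by_cases hjk : j = k
  · subst hjk; simp [homotopyEigenvalue]
  · simp [hjk, Ne.symm hjk]

variable [FiniteDimensional ℝ E] [MeasurableSpace E] [BorelSpace E]

/-- The asymptotics of `∫ χ e^{ilS}` for a reference amplitude `χ`, relative to the Gaussian. -/
theorem exists_norm_sqrtDet_mul_sub_le {S : E → ℝ} (hS : ContDiff ℝ ∞ S) (hS0 : S 0 = 0)
    (hdS : fderiv ℝ S 0 = 0) (u : OrthonormalBasis ι ℝ E) {h : ι → ℝ} (hne : ∀ j, h j ≠ 0)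
    (hH : ∀ j k, fderiv ℝ (fderiv ℝ S) 0 (u j) (u k) = if j = k then h j else 0)
    {R : ℝ} (hR : 0 < R)
    (hdiv : ∀ c : ℝ × E → ℂ, IsAmplitude R c → (∀ s, c (s, 0) = 0) →
      ∃ b : ι → ℝ × E → ℂ, (∀ j, IsAmplitude R (b j)) ∧ ∀ s ∈ Icc (0 : ℝ) 1, ∀ y,
        c (s, y) = ∑ j, b j (s, y) * dirDeriv (u j) (gaussianHomotopy S) (s, y))
    {χ : E → ℂ} (hχ : IsAmplitude R fun q : ℝ × E => χ q.2) (hχ0 : χ 0 = 1) (N : ℕ) :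
    ∃ C, 0 ≤ C ∧ ∀ l, 1 ≤ l →
      ‖sqrtDet h 1 * expIntegral (gaussianHomotopy S) (fun q => χ q.2) 1 l -
        expIntegral (gaussianHomotopy S) (fun q => χ q.2) 0 l‖ ≤
      C / l * ‖expIntegral (gaussianHomotopy S) (fun q => χ q.2) 0 l‖ + C / l ^ N := by
  set Φ := gaussianHomotopy S with hΦdef
  have hΦ : ContDiff ℝ ∞ Φ := contDiff_gaussianHomotopy hS
  -- `Φ'` is the derivative of `Φ` in `s`. It vanishes at `y = 0`, even to second order, so `Φ' χ`
  -- can be divided by the gradient of `Φ`; one integration by parts then cancels the factor `l` in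
  -- `F'`.
  let Φ' : ℝ × E → ℂ := fun q => -((‖q.2‖ ^ 2 / 2 : ℝ) : ℂ) - I * S q.2
  have hΦ' : ContDiff ℝ ∞ Φ' :=
    (ofRealCLM.contDiff.comp (((contDiff_norm_sq ℝ).comp contDiff_snd).div_const 2)).neg.sub
      (contDiff_const.mul (ofRealCLM.contDiff.comp (hS.comp contDiff_snd)))
  have hc : IsAmplitude R fun q : ℝ × E => Φ' q * χ q.2 := hχ.mul_left hΦ'
  obtain ⟨b, hb, hbc⟩ := hdiv _ hc fun s => by simp [Φ', hS0]
  have he := IsAmplitude.sum hR fun j => (hb j).dirDeriv (u j)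
  set e : ℝ × E → ℂ := fun q => ∑ j, dirDeriv (u j) (b j) q with hedef
  -- the value of the divergence at the critical point
  have htr : ∀ s ∈ Icc (0 : ℝ) 1,
      e (s, 0) = ∑ j, (-(1 / 2) - I * (h j / 2)) / homotopyEigenvalue h j s := fun s hs => by
    have hline : ∀ k, HasDerivAt (fun t : ℝ => t • u k) (u k) 0 := fun k => by
      simpa using (hasDerivAt_id (0 : ℝ)).smul_const (u k)
    have hslice : ∀ {f : ℝ × E → ℂ}, ContDiff ℝ ∞ f → ∀ k,
        HasDerivAt (fun t : ℝ => f (s, t • u k)) (dirDeriv (u k) f (s, 0)) 0 := fun {f} hf k =>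
      ((hf.comp (contDiff_prodMk_right s)).differentiable
        (by simp)).differentiableAt.hasFDerivAt.comp_hasDerivAt_of_eq (0 : ℝ) (hline k)
          (zero_smul ℝ (u k)).symm
    have hγ0 : ∀ j k, dirDeriv (u j) Φ (s, (0 : ℝ) • u k) = 0 := fun j k => by
      rw [hΦdef, dirDeriv_gaussianHomotopy hS]
      simp [hdS]
    have hγ : ∀ k j, HasDerivAt (fun t : ℝ => dirDeriv (u j) Φ (s, t • u k))
        (if j = k then homotopyEigenvalue h k s else 0) 0 := fun k j => by
      have h1 := hslice (ContDiff.dirDeriv hΦ (u j)) k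
      rw [hΦdef, dirDeriv_dirDeriv_gaussianHomotopy hS u hH] at h1
      refine h1.congr_deriv ?_
      split_ifs with hjk
      · rw [hjk]
      · rfl
    -- Along the `k`-th eigenvector the `t²` coefficient of `Φ' χ` is `λ_k'/2`, where `λ_k' = -1 - i
    -- h_k` is the derivative of the eigenvalue in `s`.
    have hlim : ∀ k, Tendsto (fun t : ℝ => (∑ j, b j (s, t • u k) *
        dirDeriv (u j) Φ (s, t • u k)) / (t : ℂ) ^ 2) (𝓝[≠] 0)
        (𝓝 (-(1 / 2) - I * (h k / 2))) := fun k => by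
      have h1 := tendsto_div_sq hS hS0 hdS (u k)
      rw [hH, if_pos rfl] at h1
      have h2 : Tendsto (fun t : ℝ => -(1 / 2 : ℂ) - I * ((S (t • u k) / t ^ 2 : ℝ) : ℂ)) (𝓝[≠] 0)
          (𝓝 (-(1 / 2) - I * ((h k / 2 : ℝ) : ℂ))) :=
        tendsto_const_nhds.sub (tendsto_const_nhds.mul
          ((continuous_ofReal.tendsto _).comp h1))
      have h3 : Tendsto (fun t : ℝ => χ (t • u k)) (𝓝[≠] 0) (𝓝 1) := by
        have hχc : Continuous χ := (hχ.contDiff_slice 0).continuous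
        have : Tendsto (fun t : ℝ => χ (t • u k)) (𝓝 0) (𝓝 (χ ((0 : ℝ) • u k))) :=
          (hχc.comp (by fun_prop : Continuous fun t : ℝ => t • u k)).tendsto 0
        rw [zero_smul, hχ0] at this
        exact this.mono_left nhdsWithin_le_nhds
      have h4 := h2.mul h3
      rw [mul_one, ofReal_div, ofReal_ofNat] at h4
      refine h4.congr' ?_
      filter_upwards [self_mem_nhdsWithin] with t (ht : t ≠ 0)
      have ht' : (t : ℂ) ≠ 0 := ofReal_ne_zero.2 ht
      rw [← hbc s hs]
      simp only [Φ', norm_smul, u.norm_eq_one, mul_one, Real.norm_eq_abs, sq_abs]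
      push_cast
      field_simp
    have hβ0 : ∀ k, b k (s, 0) = 0 := fun k => by
      have := apply_zero_eq_zero_of_tendsto (β := fun j t => b j (s, t • u k))
        (γ := fun j t => dirDeriv (u j) Φ (s, t • u k))
        (homotopyEigenvalue_ne_zero hne k s) k
        (fun j => (hslice (hb j).1 k).continuousAt) (fun j => hγ0 j k) (hγ k) (hlim k)
      simpa using this
    -- Each `∂_k b_k (s, 0)` equals `λ_k'/(2 λ_k)`, so the divergence at the critical point is the
    -- logarithmic derivative of `sqrtDet`.
    refine Finset.sum_congr rfl fun k _ => ?_
    exact deriv_eq_div_of_tendsto (β := fun j t => b j (s, t • u k))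
      (γ := fun j t => dirDeriv (u j) Φ (s, t • u k))
      (homotopyEigenvalue_ne_zero hne k s) k (β' := fun j => dirDeriv (u k) (b j) (s, 0))
      (fun j => hslice (hb j).1 k) (fun j => by simpa using hβ0 j) (fun j => hγ0 j k) (hγ k)
      (hlim k)
  obtain ⟨C, hC, hCe⟩ := exists_norm_expIntegral_sub_le hΦ hR gaussianHomotopy_re u hdiv hχ
    (fun _ => hχ0) N he
  obtain ⟨K, hK⟩ := isCompact_Icc.exists_bound_of_continuousOn (s := Icc (0 : ℝ) 1)
    (f := sqrtDet h) fun s hs => (hasDerivAt_sqrtDet hne hs).continuousAt.continuousWithinAt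
  have hK0 : 0 ≤ K := (norm_nonneg _).trans (hK 0 (by simp))
  refine ⟨C * Real.exp (C + 1) + C * Real.exp (C + 1) * (K * C) + K * C, by positivity,
    fun l hl => ?_⟩
  have hl0 : 0 < l := zero_lt_one.trans_le hl
  set F : ℝ → ℂ := fun s => expIntegral Φ (fun q => χ q.2) s l with hF
  have hFd : ∀ s ∈ Icc (0 : ℝ) 1, HasDerivAt F (-expIntegral Φ e s l) s := fun s hs => by
    refine (hasDerivAt_expIntegral hΦ hΦ'.continuous
      (fun s y => hasDerivAt_gaussianHomotopy S s y) hχ s l).congr_deriv ?_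
    have hp := mul_integral_sum_fderiv_mul_cexp u (Ψ := fun y => Φ (s, y))
        (hΦ.comp (contDiff_prodMk_right s)) (fun j => (hb j).contDiff_slice s)
        (fun j => (hb j).hasCompactSupport s) l
    rw [neg_mul]
    congr 1
    refine Eq.trans ?_ hp
    rw [expIntegral]
    congr 2 with y
    rw [hbc s hs y]
    rfl
  -- In the derivative of `sqrtDet h s * F s` the leading part `e(s,0) F s` cancels, leaving only
  -- the error of the amplitude comparison, which is `C / l` relative to the product itself plus
  -- `O(l^{-N})`.
  have hG := norm_sub_le_of_norm_deriv_le (G := fun s => sqrtDet h s * F s) (κ := C / l) (C := C)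
    (ε := K * (C / l ^ N)) (by positivity) (by positivity) (div_le_self hC hl)
    (fun s hs => (hasDerivAt_sqrtDet hne hs).mul (hFd s hs)) (fun s hs => ?_)
  · simp only [sqrtDet_zero, one_mul] at hG
    refine hG.trans ?_
    have hlN : C / l / l ^ N ≤ C / l ^ N := by gcongr; exact div_le_self hC hl
    have hexp : 0 < Real.exp (C + 1) := Real.exp_pos _
    calc C / l * (Real.exp (C + 1) * (‖F 0‖ + K * (C / l ^ N))) + K * (C / l ^ N)
        = C * Real.exp (C + 1) / l * ‖F 0‖ +
          (Real.exp (C + 1) * (K * C) * (C / l / l ^ N) + K * C / l ^ N) := by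
            field_simp
            ring
      _ ≤ C * Real.exp (C + 1) / l * ‖F 0‖ +
          (Real.exp (C + 1) * (K * C) * (C / l ^ N) + K * C / l ^ N) := by gcongr
      _ = C * Real.exp (C + 1) / l * ‖F 0‖ +
          (C * Real.exp (C + 1) * (K * C) + K * C) / l ^ N := by ring
      _ ≤ _ := by
        gcongr
        · have : 0 ≤ C * Real.exp (C + 1) * (K * C) := by positivity
          have : 0 ≤ K * C := by positivity
          linarith
        · have : 0 ≤ C * Real.exp (C + 1) := by positivity
          linarith
  · rw [← htr s hs]
    have h1 : e (s, 0) * sqrtDet h s * F s + sqrtDet h s * -expIntegral Φ e s l =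
        -(sqrtDet h s * (expIntegral Φ e s l - e (s, 0) * F s)) := by ring
    rw [h1, norm_neg, norm_mul, norm_mul]
    calc _ ≤ ‖sqrtDet h s‖ * (C / l * ‖F s‖ + C / l ^ N) := by
          gcongr; exact hCe s hs l hl
      _ = C / l * (‖sqrtDet h s‖ * ‖F s‖) + ‖sqrtDet h s‖ * (C / l ^ N) := by ring
      _ ≤ _ := by gcongr; exact hK s hs

end Local

/-- Shows that the choice `N = d + 1` of remainder order suffices, because `d + 1 ≥ 1 + d/2`. -/
theorem one_div_pow_le_rpow {l : ℝ} (hl : 1 ≤ l) (d : ℕ) :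
    1 / l ^ (d + 1) ≤ l ^ (-(1 + (d : ℝ) / 2)) := by
  have hl0 : 0 < l := zero_lt_one.trans_le hl
  rw [one_div, ← Real.rpow_natCast, ← Real.rpow_neg hl0.le]
  refine Real.rpow_le_rpow_of_exponent_le hl ?_
  push_cast
  have : (0 : ℝ) ≤ d := by positivity
  linarith

/-! ### Local asymptotics at critical and noncritical points. -/

section Local

variable {ι : Type*} [Fintype ι] {E : Type*} [NormedAddCommGroup E] [InnerProductSpace ℝ E]
  [FiniteDimensional ℝ E] [MeasurableSpace E] [BorelSpace E]

/-- Stationary phase at a single nondegenerate critical point, for amplitudes supported near it. -/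
theorem exists_norm_integral_sub_le_of_critical [DecidableEq ι] {S : E → ℝ} (hS : ContDiff ℝ ∞ S)
    (hS0 : S 0 = 0) (hdS : fderiv ℝ S 0 = 0) (u : OrthonormalBasis ι ℝ E) {h : ι → ℝ}
    (hne : ∀ j, h j ≠ 0)
    (hH : ∀ j k, fderiv ℝ (fderiv ℝ S) 0 (u j) (u k) = if j = k then h j else 0) :
    ∃ R > 0, ∀ a : E → ℂ, ContDiff ℝ ∞ a → (∃ r < R, ∀ y, r ≤ ‖y‖ → a y = 0) →
      ∃ C, ∀ l : ℝ, 1 ≤ l →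
        ‖(∫ y, a y * cexp (I * l * S y)) -
          (((2 * Real.pi / l) ^ ((Module.finrank ℝ E : ℝ) / 2) : ℝ) : ℂ) *
            (a 0 * (sqrtDet h 1)⁻¹)‖ ≤ C * l ^ (-(1 + (Module.finrank ℝ E : ℝ) / 2)) := by
  have hΦ := contDiff_gaussianHomotopy hS
  obtain ⟨R, hR, hdiv⟩ := exists_amplitude_division u
    (d := fun j => dirDeriv (u j) (gaussianHomotopy S)) (fun j => ContDiff.dirDeriv hΦ (u j))
    (fun j s => by rw [dirDeriv_gaussianHomotopy hS]; simp [hdS])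
    (fun j s => homotopyEigenvalue_ne_zero hne j s)
    (fun j k s => dirDeriv_dirDeriv_gaussianHomotopy hS u hH j k s)
  refine ⟨R, hR, fun a ha hasupp => ?_⟩
  let χ : ContDiffBump (0 : E) := ⟨R / 3, R / 2, by positivity, by linarith⟩
  let χ' : E → ℂ := fun y => (χ y : ℂ)
  have hχ : IsAmplitude R fun q : ℝ × E => χ' q.2 := by
    refine ⟨ofRealCLM.contDiff.comp (χ.contDiff.comp contDiff_snd), R / 2, by linarith,
      fun s y hy => ?_⟩
    simp [χ', χ.zero_of_le_dist (x := y) (by simpa using hy)]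
  have hχ0 : χ' 0 = 1 := by
    simp [χ', χ.one_of_mem_closedBall (x := (0 : E)) (by simpa using χ.rIn_pos.le)]
  have haA : IsAmplitude R fun q : ℝ × E => a q.2 := by
    obtain ⟨r, hr, h0⟩ := hasupp
    exact ⟨ha.comp contDiff_snd, r, hr, fun s y hy => h0 y hy⟩
  set d := Module.finrank ℝ E with hd
  obtain ⟨C₀, hC₀, h₀⟩ := exists_norm_integral_gaussian_sub_le (E := E) (χ := χ) χ.continuous
    (r := R / 3) (by positivity)
    (fun y hy => χ.one_of_mem_closedBall (by simpa using hy))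
    (fun y => ⟨χ.nonneg, χ.le_one⟩) (d + 1)
  obtain ⟨C₁, hC₁, h₁⟩ := exists_norm_sqrtDet_mul_sub_le hS hS0 hdS u hne hH hR hdiv hχ hχ0 (d + 1)
  obtain ⟨C₂, hC₂, h₂⟩ := exists_norm_expIntegral_sub_le hΦ hR gaussianHomotopy_re u hdiv hχ
    (fun _ => hχ0) (d + 1) haA
  have hD0 : sqrtDet h 1 ≠ 0 := exp_ne_zero _
  set D := sqrtDet h 1
  set P : ℝ := (2 * Real.pi) ^ ((d : ℝ) / 2) with hP
  have hP0 : 0 ≤ P := by positivity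
  set k := ‖D⁻¹‖
  set K₁ := C₁ * (P + C₀) + C₁ with hK₁
  set K₂ := K₁ + C₀ with hK₂
  refine ⟨C₂ * (k * (K₂ + P)) + C₂ + ‖a 0‖ * (k * K₂), fun l hl => ?_⟩
  have hl0 : 0 < l := zero_lt_one.trans_le hl
  set w : ℝ := l ^ (-(1 + (d : ℝ) / 2)) with hw
  have hw0 : 0 ≤ w := by positivity
  have hpow := one_div_pow_le_rpow hl d
  have hNw : ∀ C, 0 ≤ C → C / l ^ (d + 1) ≤ C * w := fun C hC => by
    rw [div_eq_mul_one_div]; gcongr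
  set p : ℝ := (2 * Real.pi / l) ^ ((d : ℝ) / 2) with hp
  have hp0 : 0 ≤ p := by positivity
  -- The Gaussian main term divided by `l` is exactly of the size allowed for the error, so relative
  -- errors `O(1/l)` are admissible.
  have hpw : p / l = P * w := by
    rw [hp, hP, hw, Real.div_rpow (by positivity) hl0.le, neg_add, Real.rpow_add hl0,
      Real.rpow_neg hl0.le, Real.rpow_neg hl0.le, Real.rpow_one]
    field_simp
  set F : ℝ → ℂ := fun s => expIntegral (gaussianHomotopy S) (fun q => χ' q.2) s l with hF
  have hF0 : ‖F 0 - p‖ ≤ C₀ * w := by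
    refine le_trans (le_of_eq ?_) ((h₀ l hl).trans (hNw C₀ hC₀))
    congr 2
    refine integral_congr_ae (Eventually.of_forall fun y => ?_)
    simp only [χ', gaussianHomotopy]
    rw [ofReal_exp]
    push_cast
    congr 2
    ring
  have hwl : ∀ C, 0 ≤ C → C * w / l ≤ C * w := fun C hC =>
    div_le_self (by positivity) hl
  have hF0l : ‖F 0‖ / l ≤ (P + C₀) * w := by
    have : ‖F 0‖ ≤ C₀ * w + p := by
      calc ‖F 0‖ = ‖(F 0 - p) + p‖ := by rw [sub_add_cancel]
        _ ≤ ‖F 0 - p‖ + ‖(p : ℂ)‖ := norm_add_le _ _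
        _ ≤ C₀ * w + p := by
          rw [Complex.norm_real, Real.norm_eq_abs, abs_of_nonneg hp0]; gcongr
    calc ‖F 0‖ / l ≤ (C₀ * w + p) / l := by gcongr
      _ = C₀ * w / l + p / l := add_div _ _ _
      _ ≤ C₀ * w + P * w := add_le_add (hwl C₀ hC₀) hpw.le
      _ = _ := by ring
  have hDF : ‖D * F 1 - F 0‖ ≤ K₁ * w := by
    calc ‖D * F 1 - F 0‖ ≤ C₁ / l * ‖F 0‖ + C₁ / l ^ (d + 1) := h₁ l hl
      _ = C₁ * (‖F 0‖ / l) + C₁ / l ^ (d + 1) := by ring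
      _ ≤ C₁ * ((P + C₀) * w) + C₁ * w := by gcongr; exact hNw C₁ hC₁
      _ = K₁ * w := by rw [hK₁]; ring
  have hDp : ‖D * F 1 - p‖ ≤ K₂ * w := by
    calc ‖D * F 1 - p‖ = ‖(D * F 1 - F 0) + (F 0 - p)‖ := by congr 1; ring
      _ ≤ K₁ * w + C₀ * w := (norm_add_le _ _).trans (add_le_add hDF hF0)
      _ = _ := by rw [hK₂]; ring
  have hK₂0 : 0 ≤ K₂ := by positivity
  have hDl : ‖D * F 1‖ / l ≤ (K₂ + P) * w := by
    have : ‖D * F 1‖ ≤ K₂ * w + p := by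
      calc ‖D * F 1‖ = ‖(D * F 1 - p) + p‖ := by rw [sub_add_cancel]
        _ ≤ ‖D * F 1 - p‖ + ‖(p : ℂ)‖ := norm_add_le _ _
        _ ≤ K₂ * w + p := by
          rw [Complex.norm_real, Real.norm_eq_abs, abs_of_nonneg hp0]; gcongr
    calc ‖D * F 1‖ / l ≤ (K₂ * w + p) / l := by gcongr
      _ = K₂ * w / l + p / l := add_div _ _ _
      _ ≤ K₂ * w + P * w := add_le_add (hwl K₂ hK₂0) hpw.le
      _ = _ := by ring
  have hF1 : ‖F 1 - D⁻¹ * p‖ ≤ k * K₂ * w := by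
    have : F 1 - D⁻¹ * p = D⁻¹ * (D * F 1 - p) := by field_simp
    rw [this, norm_mul, mul_assoc]
    gcongr
  have hF1l : ‖F 1‖ / l ≤ k * ((K₂ + P) * w) := by
    have : F 1 = D⁻¹ * (D * F 1) := by field_simp
    rw [this, norm_mul, mul_div_assoc]
    gcongr
  have hI : (∫ y, a y * cexp (I * l * S y)) =
      expIntegral (gaussianHomotopy S) (fun q => a q.2) 1 l := by
    refine integral_congr_ae (Eventually.of_forall fun y => ?_)
    simp only [gaussianHomotopy]
    congr 2
    push_cast
    ring
  have h2 := h₂ 1 (by simp) l hl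
  rw [hI]
  calc _ = ‖(expIntegral (gaussianHomotopy S) (fun q => a q.2) 1 l - a 0 * F 1) +
        a 0 * (F 1 - D⁻¹ * p)‖ := by congr 1; ring
    _ ≤ (C₂ / l * ‖F 1‖ + C₂ / l ^ (d + 1)) + ‖a 0‖ * (k * K₂ * w) := by
        refine (norm_add_le _ _).trans (add_le_add h2 ?_)
        rw [norm_mul]
        gcongr
    _ = C₂ * (‖F 1‖ / l) + C₂ / l ^ (d + 1) + ‖a 0‖ * (k * K₂ * w) := by ring
    _ ≤ C₂ * (k * ((K₂ + P) * w)) + C₂ * w + ‖a 0‖ * (k * K₂ * w) := by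
        gcongr; exact hNw C₂ hC₂
    _ = _ := by ring

/-- The principle of nonstationary phase. -/
theorem exists_norm_integral_le_of_noncritical {S : E → ℝ} (hS : ContDiff ℝ ∞ S) (N : ℕ)
    {a : E → ℂ} (ha : ContDiff ℝ ∞ a) (hac : HasCompactSupport a)
    (hcrit : ∀ y ∈ tsupport a, fderiv ℝ S y ≠ 0) :
    ∃ C, 0 ≤ C ∧ ∀ l : ℝ, 1 ≤ l → ‖∫ y, a y * cexp (I * l * S y)‖ ≤ C / l ^ N := by
  induction N generalizing a with
  | zero =>
    refine ⟨∫ y, ‖a y‖, integral_nonneg fun y => norm_nonneg _, fun l hl => ?_⟩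
    rw [pow_zero, div_one]
    refine norm_integral_le_of_norm_le
      (ha.continuous.integrable_of_hasCompactSupport hac).norm (Eventually.of_forall fun y => ?_)
    have h1 : I * l * S y = ((l * S y : ℝ) : ℂ) * I := by push_cast; ring
    rw [norm_mul, h1, norm_exp_ofReal_mul_I, mul_one]
  | succ N ih =>
    let u := stdOrthonormalBasis ℝ E
    let g : E → ℝ := fun y => ∑ j, (fderiv ℝ S y (u j)) ^ 2
    have hSd : ∀ j, ContDiff ℝ ∞ fun y => fderiv ℝ S y (u j) := fun j =>
      (hS.fderiv_right (m := ∞) (by simp)).clm_apply contDiff_const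
    have hg : ContDiff ℝ ∞ g := ContDiff.sum fun j _ => (hSd j).pow 2
    have hg0 : ∀ y, fderiv ℝ S y ≠ 0 → g y ≠ 0 := fun y hy h0 => by
      refine hy ?_
      have h1 := (Finset.sum_eq_zero_iff_of_nonneg fun j _ => sq_nonneg _).1 h0
      have h2 : (fderiv ℝ S y).toLinearMap = 0 := u.toBasis.ext fun j => by
        simpa using h1 j (Finset.mem_univ j)
      ext v
      exact congrArg (fun L : E →ₗ[ℝ] ℝ => L v) h2
    -- The field `i a ∇S/|∇S|²` satisfies `∑ b_j ∂_jΨ = a` for `Ψ = -iS`. It is smooth because the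
    -- denominator is nonzero on `tsupport a`, and its divergence keeps the support inside `tsupport
    -- a`, so the integration by parts can be repeated.
    let b : Fin (Module.finrank ℝ E) → E → ℂ := fun j y =>
      a y * (I * ((fderiv ℝ S y (u j) / g y : ℝ) : ℂ))
    have hbs : ∀ j, tsupport (b j) ⊆ tsupport a := fun j => tsupport_mul_subset_left
    have hb : ∀ j, ContDiff ℝ ∞ (b j) := fun j => contDiff_of_tsupport fun y hy =>
      ha.contDiffAt.mul (contDiffAt_const.mul (ofRealCLM.contDiff.contDiffAt.comp y
        ((hSd j).contDiffAt.div hg.contDiffAt (hg0 y (hcrit y (hbs j hy))))))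
    have hbc : ∀ j, HasCompactSupport (b j) := fun j => hac.mul_right
    let e : E → ℂ := fun y => ∑ j, fderiv ℝ (b j) y (u j)
    have hes : tsupport e ⊆ tsupport a := by
      refine closure_minimal (fun y hy => ?_) (isClosed_tsupport a)
      by_contra hya
      refine hy (Finset.sum_eq_zero fun j _ => ?_)
      have : fderiv ℝ (b j) y = 0 := by
        by_contra h0
        exact hya (hbs j (support_fderiv_subset ℝ h0))
      simp [this]
    have he : ContDiff ℝ ∞ e := ContDiff.sum fun j _ =>
      ((hb j).fderiv_right (m := ∞) (by simp)).clm_apply contDiff_const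
    obtain ⟨C, hC, hCe⟩ := ih he (hac.of_isClosed_subset (isClosed_tsupport e) hes)
      fun y hy => hcrit y (hes hy)
    refine ⟨C, hC, fun l hl => ?_⟩
    have hl0 : 0 < l := zero_lt_one.trans_le hl
    let Ψ : E → ℂ := fun y => -I * S y
    have hΨ : ContDiff ℝ ∞ Ψ := contDiff_const.mul (ofRealCLM.contDiff.comp hS)
    have hΨd : ∀ y j, fderiv ℝ Ψ y (u j) = -I * (fderiv ℝ S y (u j) : ℝ) := fun y j => by
      have h1 : HasFDerivAt Ψ _ y := ((ofRealCLM.hasFDerivAt.comp y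
        (hS.differentiable (by simp)).differentiableAt.hasFDerivAt).const_mul (-I))
      rw [h1.fderiv]
      simp
    have hsum : ∀ y, ∑ j, b j y * fderiv ℝ Ψ y (u j) = a y := fun y => by
      by_cases hy : y ∈ tsupport a
      · have hgy : ((g y : ℝ) : ℂ) ≠ 0 := ofReal_ne_zero.2 (hg0 y (hcrit y hy))
        have h1 : ∀ j, b j y * fderiv ℝ Ψ y (u j) =
            a y / (g y : ℂ) * (((fderiv ℝ S y (u j)) ^ 2 : ℝ) : ℂ) := fun j => by
          rw [hΨd]
          simp only [b]
          push_cast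
          field_simp
          rw [I_sq]
          ring
        simp only [h1]
        rw [← Finset.mul_sum, ← ofReal_sum]
        field_simp
        rfl
      · have h0 := image_eq_zero_of_notMem_tsupport hy
        simp [b, h0]
    have hp := mul_integral_sum_fderiv_mul_cexp u hΨ hb hbc l
    have hexp : ∀ y, cexp (-(l : ℂ) * Ψ y) = cexp (I * l * S y) := fun y => by
      congr 1
      simp only [Ψ]
      ring
    simp only [hsum, hexp] at hp
    have hn := congrArg norm hp
    rw [norm_mul, Complex.norm_real, Real.norm_eq_abs, abs_of_pos hl0] at hn
    have hCl := hCe l hl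
    rw [pow_succ, ← div_div, le_div_iff₀ hl0, mul_comm, hn]
    exact hCl

end Local

/-! ### Signature, diagonalisation and the Hessian factor. -/

section LinearAlgebra

variable {n : ℕ}

theorem toQuadraticForm'_apply (H : Matrix (Fin n) (Fin n) ℝ) (x : Fin n → ℝ) :
    H.toQuadraticForm' x = x ⬝ᵥ H.mulVec x := by
  simp [Matrix.toQuadraticForm', Matrix.toLinearMap₂'_apply']

/-- Sylvester's law of inertia: the signature is invariant under congruence. -/
theorem signature_transpose_mul_mul (H J : Matrix (Fin n) (Fin n) ℝ) (hJ : J.det ≠ 0) :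
    signature (J.transpose * H * J) = signature H := by
  have hJu : IsUnit J.det := isUnit_iff_ne_zero.2 hJ
  have heq : (J.transpose * H * J).toQuadraticForm'.Equivalent H.toQuadraticForm' := by
    refine ⟨⟨Matrix.toLinearEquiv' J (J.invertibleOfIsUnitDet hJu), fun x => ?_⟩⟩
    change H.toQuadraticForm' (J.mulVec x) = _
    rw [toQuadraticForm'_apply, toQuadraticForm'_apply, ← Matrix.mulVec_mulVec,
      ← Matrix.mulVec_mulVec, Matrix.dotProduct_mulVec x, Matrix.vecMul_transpose]
  rw [signature, signature, heq.sigPos_eq, heq.sigNeg_eq]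

theorem signature_diagonal (h : Fin n → ℝ) :
    signature (Matrix.diagonal h) = ∑ j, (SignType.sign (h j) : ℤ) := by
  have hQ : (Matrix.diagonal h).toQuadraticForm' = QuadraticMap.weightedSumSquares ℝ h := by
    ext x
    rw [toQuadraticForm'_apply, QuadraticMap.weightedSumSquares_apply]
    simp only [dotProduct, Matrix.mulVec_diagonal, smul_eq_mul]
    exact Finset.sum_congr rfl fun j _ => by ring
  have hcard : ∀ P : Fin n → Prop, ∀ _ : DecidablePred P,
      ({i | P i}.ncard : ℤ) = ∑ i, if P i then 1 else 0 := fun P _ => by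
    rw [Set.ncard_eq_toFinset_card', Finset.sum_boole]
    simp
  rw [signature, hQ, QuadraticForm.sigPos_weightedSumSquares,
    QuadraticForm.sigNeg_weightedSumSquares, hcard _ (Classical.decPred _),
    hcard _ (Classical.decPred _), ← Finset.sum_sub_distrib]
  refine Finset.sum_congr rfl fun j _ => ?_
  rcases lt_trichotomy (h j) 0 with hj | hj | hj
  · simp [hj, hj.le]
  · simp [hj]
  · simp [hj, hj.le]

theorem cexp_log_homotopyEigenvalue_one {ι : Type*} {h : ι → ℝ} (j : ι) (hj : h j ≠ 0) :
    cexp (log (homotopyEigenvalue h j 1) / 2) =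
      (Real.sqrt |h j| : ℝ) * cexp (-(I * Real.pi / 4 * (SignType.sign (h j) : ℤ))) := by
  have hsq : ∀ x : ℝ, 0 < x → cexp ((Real.log x : ℝ) / 2) = (Real.sqrt x : ℝ) := fun x hx => by
    rw [Real.sqrt_eq_rpow, Real.rpow_def_of_pos hx, ofReal_exp]
    congr 1
    push_cast
    ring
  rcases lt_or_gt_of_ne hj with hneg | hpos
  · have h1 : homotopyEigenvalue h j 1 = ((-h j : ℝ) : ℂ) * I := by
      simp [homotopyEigenvalue]; ring
    rw [h1, log_ofReal_mul (neg_pos.2 hneg) I_ne_zero, log_I, add_div, exp_add,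
      hsq _ (neg_pos.2 hneg), abs_of_neg hneg, sign_neg hneg]
    congr 2
    simp
    ring
  · have h1 : homotopyEigenvalue h j 1 = ((h j : ℝ) : ℂ) * (-I) := by
      simp [homotopyEigenvalue]; ring
    rw [h1, log_ofReal_mul hpos (neg_ne_zero.2 I_ne_zero), log_neg_I, add_div, exp_add,
      hsq _ hpos, abs_of_pos hpos, sign_pos hpos]
    congr 2
    simp
    ring

/-- The homotopy ends at the eigenvalues `-i h_j`, whose principal roots are `|h_j|^{1/2} e^{-iπ
sign(h_j)/4}`; inverting their product adds the phases up to the signature. -/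
theorem inv_sqrtDet_one {h : Fin n → ℝ} (hne : ∀ j, h j ≠ 0) :
    (sqrtDet h 1)⁻¹ = cexp (I * Real.pi / 4 * signature (Matrix.diagonal h)) /
      (Real.sqrt |∏ j, h j| : ℝ) := by
  rw [sqrtDet, exp_sum, signature_diagonal]
  simp only [fun j => cexp_log_homotopyEigenvalue_one j (hne j)]
  rw [Finset.prod_mul_distrib, ← exp_sum, Finset.sum_neg_distrib, exp_neg, mul_inv, inv_inv,
    ← Finset.mul_sum, Finset.abs_prod, Real.sqrt_prod _ fun j _ => abs_nonneg _]
  push_cast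
  exact (div_eq_inv_mul _ _).symm

/-- The Hessian matrix of a function on `ℝⁿ`. -/
noncomputable def hessian (f : Model n → ℝ) (y : Model n) : Matrix (Fin n) (Fin n) ℝ :=
  Matrix.of fun i j =>
    iteratedFDeriv ℝ 2 f y ![EuclideanSpace.single i (1 : ℝ), EuclideanSpace.single j (1 : ℝ)]

theorem hessian_apply (f : Model n → ℝ) (y : Model n) (i j : Fin n) :
    hessian f y i j = fderiv ℝ (fderiv ℝ f) y (EuclideanSpace.single i 1)
      (EuclideanSpace.single j 1) := by
  simp [hessian, iteratedFDeriv_two_apply]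

theorem euclideanSpace_eq_sum_single (v : Model n) :
    v = ∑ i, v i • (EuclideanSpace.single i 1 : Model n) := by
  conv_lhs => rw [← (EuclideanSpace.basisFun (Fin n) ℝ).sum_repr v]
  simp

theorem fderiv_fderiv_apply_eq_dotProduct (f : Model n → ℝ) (y v w : Model n) :
    fderiv ℝ (fderiv ℝ f) y v w = v.ofLp ⬝ᵥ (hessian f y).mulVec w.ofLp := by
  conv_lhs => rw [euclideanSpace_eq_sum_single v, euclideanSpace_eq_sum_single w]
  simp only [map_sum, map_smul, sum_apply, smul_apply, smul_eq_mul, dotProduct, Matrix.mulVec,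
    ← hessian_apply, Finset.mul_sum]
  rw [Finset.sum_comm]
  exact Finset.sum_congr rfl fun i _ => Finset.sum_congr rfl fun j _ => by ring

theorem hessian_isHermitian {f : Model n → ℝ} {y : Model n} (hf : ContDiffAt ℝ ∞ f y) :
    (hessian f y).IsHermitian := by
  refine Matrix.IsHermitian.ext fun i j => ?_
  rw [star_trivial, hessian_apply, hessian_apply]
  have h2 : (2 : WithTop ℕ∞) ≤ ∞ := WithTop.coe_le_coe.2 (le_top : (2 : ℕ∞) ≤ ⊤)
  exact hf.isSymmSndFDerivAt (by simpa using h2) _ _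

/-- The factor `e^{iπ sign(H)/4} / |det H|^{1/2}` of the stationary phase formula. -/
noncomputable def hessianFactor (H : Matrix (Fin n) (Fin n) ℝ) : ℂ :=
  cexp (I * Real.pi / 4 * signature H) / (Real.sqrt |H.det| : ℝ)

/-- An orthonormal basis of eigenvectors of the Hessian. -/
theorem exists_orthonormalBasis_hessian {f : Model n → ℝ} {y : Model n}
    (hf : ContDiffAt ℝ ∞ f y) (hdet : (hessian f y).det ≠ 0) :
    ∃ (u : OrthonormalBasis (Fin n) ℝ (Model n)) (h : Fin n → ℝ), (∀ j, h j ≠ 0) ∧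
      (∀ j k, fderiv ℝ (fderiv ℝ f) y (u j) (u k) = if j = k then h j else 0) ∧
      (sqrtDet h 1)⁻¹ = hessianFactor (hessian f y) := by
  have hH := hessian_isHermitian hf
  have hprod : (hessian f y).det = ∏ j, hH.eigenvalues j := hH.det_eq_prod_eigenvalues
  have hne : ∀ j, hH.eigenvalues j ≠ 0 := fun j h0 =>
    hdet (hprod ▸ Finset.prod_eq_zero (Finset.mem_univ j) h0)
  refine ⟨hH.eigenvectorBasis, hH.eigenvalues, hne, fun j k => ?_, ?_⟩
  · rw [fderiv_fderiv_apply_eq_dotProduct, hH.mulVec_eigenvectorBasis, dotProduct_smul]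
    have h1 := orthonormal_iff_ite.1 hH.eigenvectorBasis.orthonormal k j
    rw [EuclideanSpace.inner_eq_star_dotProduct, star_trivial] at h1
    rw [h1]
    by_cases hjk : j = k
    · subst hjk; simp
    · simp [hjk, Ne.symm hjk]
  · rw [inv_sqrtDet_one hne, hessianFactor, hprod]
    congr 3
    have hU := hH.conjStarAlgAut_star_eigenvectorUnitary
    rw [Unitary.conjStarAlgAut_star_apply] at hU
    have hd : (hH.eigenvectorUnitary : Matrix (Fin n) (Fin n) ℝ).det ≠ 0 := fun h0 => by
      have h1 := congrArg Matrix.det (Unitary.coe_star_mul_self hH.eigenvectorUnitary)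
      rw [Matrix.det_mul, h0, mul_zero, Matrix.det_one] at h1
      exact zero_ne_one h1
    -- Orthogonal diagonalisation is in particular a congruence, so the signature is that of the
    -- eigenvalues.
    rw [← signature_transpose_mul_mul (hessian f y) _ hd]
    congr 2
    exact hU.symm

end LinearAlgebra

/-! ### Stationary phase on `ℝⁿ` with finitely many critical points. -/

section Euclidean

variable {n : ℕ}

/-- The contribution of a critical point to the stationary phase formula. -/
noncomputable def criticalTerm (S : Model n → ℝ) (l : ℝ) (q : Model n) : ℂ :=
  cexp (I * l * S q) * hessianFactor (hessian S q)

theorem fderiv_comp_add_const (f : Model n → ℝ) (p : Model n) (c : ℝ) :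
    fderiv ℝ (fun y => f (y + p) - c) = fun y => fderiv ℝ f (y + p) := by
  funext y
  rw [fderiv_sub_const, fderiv_comp_add_right]

theorem exists_norm_integral_sub_le_near {S : Model n → ℝ} (hS : ContDiff ℝ ∞ S) {p : Model n}
    (hdS : fderiv ℝ S p = 0) (hdet : (hessian S p).det ≠ 0) :
    ∃ R > 0, ∀ a : Model n → ℂ, ContDiff ℝ ∞ a → (∃ r < R, ∀ y, r ≤ dist y p → a y = 0) →
      ∃ C, ∀ l : ℝ, 1 ≤ l →
        ‖(∫ y, a y * cexp (I * l * S y)) -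
          (((2 * Real.pi / l) ^ ((n : ℝ) / 2) : ℝ) : ℂ) * (a p * criticalTerm S l p)‖ ≤
            C * l ^ (-(1 + (n : ℝ) / 2)) := by
  obtain ⟨u, h, hne, hH, hD⟩ := exists_orthonormalBasis_hessian hS.contDiffAt hdet
  let T : Model n → ℝ := fun y => S (y + p) - S p
  have hT : ContDiff ℝ ∞ T := (hS.comp (contDiff_id.add contDiff_const)).sub contDiff_const
  have hTd : fderiv ℝ T = fun y => fderiv ℝ S (y + p) := fderiv_comp_add_const S p (S p)
  obtain ⟨R, hR, hmain⟩ := exists_norm_integral_sub_le_of_critical hT (by simp [T])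
    (by rw [hTd]; simpa using hdS) u hne (fun j k => by
      rw [hTd, fderiv_comp_add_right, zero_add]; exact hH j k)
  refine ⟨R, hR, fun a ha ⟨r, hr, hra⟩ => ?_⟩
  obtain ⟨C, hC⟩ := hmain (fun y => a (y + p)) (ha.comp (contDiff_id.add contDiff_const))
    ⟨r, hr, fun y hy => hra _ (by simpa [dist_eq_norm] using hy)⟩
  refine ⟨C, fun l hl => ?_⟩
  have h1 := hC l hl
  rw [finrank_euclideanSpace_fin] at h1
  refine le_trans (le_of_eq ?_) h1
  have hint : (∫ y, a y * cexp (I * l * S y)) =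
      cexp (I * l * S p) * ∫ y, a (y + p) * cexp (I * l * T y) := by
    rw [← integral_add_right_eq_self _ p, ← integral_const_mul]
    congr 1 with y
    have : cexp (I * l * S (y + p)) = cexp (I * l * S p) * cexp (I * l * T y) := by
      rw [← exp_add]
      congr 1
      simp only [T]
      push_cast
      ring
    rw [this]
    ring
  -- Normalising the critical value to `0` extracts a factor of modulus one, which leaves the size
  -- of the error unchanged.
  have hnorm : ‖cexp (I * l * S p)‖ = 1 := by
    have : I * l * S p = ((l * S p : ℝ) : ℂ) * I := by push_cast; ring
    rw [this, norm_exp_ofReal_mul_I]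
  rw [hint, criticalTerm, ← hD, zero_add]
  rw [← one_mul ‖(∫ y, a (y + p) * cexp (I * l * T y)) - _‖, ← hnorm, ← norm_mul]
  congr 1
  ring

/-- Stationary phase on `ℝⁿ` for a compactly supported amplitude. -/
theorem exists_norm_integral_sub_sum_le {S : Model n → ℝ} (hS : ContDiff ℝ ∞ S)
    (F : Finset (Model n)) (hF : ∀ q ∈ F, fderiv ℝ S q = 0 ∧ (hessian S q).det ≠ 0)
    {a : Model n → ℂ} (ha : ContDiff ℝ ∞ a) (hac : HasCompactSupport a)
    (hcrit : ∀ y ∈ tsupport a, fderiv ℝ S y = 0 → y ∈ F) :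
    ∃ C, ∀ l : ℝ, 1 ≤ l →
      ‖(∫ y, a y * cexp (I * l * S y)) - (((2 * Real.pi / l) ^ ((n : ℝ) / 2) : ℝ) : ℂ) *
        ∑ q ∈ F, a q * criticalTerm S l q‖ ≤ C * l ^ (-(1 + (n : ℝ) / 2)) := by
  classical
  induction F using Finset.induction_on generalizing a with
  | empty =>
    obtain ⟨C, hC, hCl⟩ := exists_norm_integral_le_of_noncritical hS (n + 1) ha hac
      fun y hy h0 => by simpa using hcrit y hy h0
    refine ⟨C, fun l hl => ?_⟩
    rw [Finset.sum_empty, mul_zero, sub_zero]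
    refine (hCl l hl).trans ?_
    rw [div_eq_mul_one_div]
    gcongr
    exact one_div_pow_le_rpow hl n
  | insert p F hp ih =>
    obtain ⟨hdp, hdet⟩ := hF p (Finset.mem_insert_self p F)
    obtain ⟨R, hR, hnear⟩ := exists_norm_integral_sub_le_near hS hdp hdet
    obtain ⟨ε, hε, hεF⟩ : ∃ ε > 0, ∀ q ∈ F, ε ≤ dist q p := by
      have hopen : IsOpen ((F : Set (Model n))ᶜ) := F.finite_toSet.isClosed.isOpen_compl
      obtain ⟨ε, hε, hsub⟩ := Metric.isOpen_iff.1 hopen p (by simpa using hp)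
      refine ⟨ε, hε, fun q hq => ?_⟩
      by_contra hlt
      exact hsub (Metric.mem_ball.2 (not_le.1 hlt)) hq
    have hm : 0 < min R ε := lt_min hR hε
    -- The outer radius is below both `R`, where the local result at `p` applies, and `ε`, so that
    -- `χ` vanishes at the other points of `F`. Then `χ a` carries the term at `p`, and `(1 - χ) a`
    -- vanishes near `p` and falls under the induction hypothesis.
    let χ : ContDiffBump p := ⟨min R ε / 3, min R ε / 2, by positivity, by linarith⟩
    let χ' : Model n → ℂ := fun y => (χ y : ℂ)
    have hχ : ContDiff ℝ ∞ χ' := ofRealCLM.contDiff.comp χ.contDiff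
    have hχ0 : ∀ y, min R ε / 2 ≤ dist y p → χ' y = 0 := fun y hy => by
      simp [χ', χ.zero_of_le_dist hy]
    have hχ1 : ∀ᶠ y in 𝓝 p, χ' y = 1 := by
      filter_upwards [χ.eventuallyEq_one] with y hy
      simp only [χ', hy, Pi.one_apply, ofReal_one]
    have hχp : χ' p = 1 := hχ1.self_of_nhds
    have hχF : ∀ q ∈ F, χ' q = 0 := fun q hq => hχ0 q (by
      have := hεF q hq
      have := min_le_right R ε
      linarith)
    let a₁ : Model n → ℂ := fun y => χ' y * a y
    let a₂ : Model n → ℂ := fun y => (1 - χ' y) * a y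
    have ha₁ : ContDiff ℝ ∞ a₁ := hχ.mul ha
    have ha₂ : ContDiff ℝ ∞ a₂ := (contDiff_const.sub hχ).mul ha
    have hac₁ : HasCompactSupport a₁ := hac.mul_left
    have hac₂ : HasCompactSupport a₂ := hac.mul_left
    obtain ⟨C₁, hC₁⟩ := hnear a₁ ha₁ ⟨min R ε / 2, by linarith [min_le_left R ε], fun y hy => by
      simp [a₁, hχ0 y hy]⟩
    obtain ⟨C₂, hC₂⟩ := ih (fun q hq => hF q (Finset.mem_insert_of_mem hq)) ha₂ hac₂
      fun y hy h0 => by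
        rcases Finset.mem_insert.1 (hcrit y (tsupport_mul_subset_right hy) h0) with rfl | hy'
        · refine absurd hy ?_
          rw [notMem_tsupport_iff_eventuallyEq]
          filter_upwards [hχ1] with z hz
          simp [a₂, hz]
        · exact hy'
    refine ⟨C₁ + C₂, fun l hl => ?_⟩
    have hint : ∀ {b : Model n → ℂ}, ContDiff ℝ ∞ b → HasCompactSupport b →
        Integrable fun y => b y * cexp (I * l * S y) := fun {b} hb hbc => by
      refine Continuous.integrable_of_hasCompactSupport ?_ hbc.mul_right
      have := hb.continuous
      have := hS.continuous
      fun_prop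
    have hsplit : (∫ y, a y * cexp (I * l * S y)) =
        (∫ y, a₁ y * cexp (I * l * S y)) + ∫ y, a₂ y * cexp (I * l * S y) := by
      rw [← integral_add (hint ha₁ hac₁) (hint ha₂ hac₂)]
      congr 1 with y
      simp only [a₁, a₂]
      ring
    have hsum : ∑ q ∈ F, a₂ q * criticalTerm S l q = ∑ q ∈ F, a q * criticalTerm S l q :=
      Finset.sum_congr rfl fun q hq => by simp [a₂, hχF q hq]
    have h₁ := hC₁ l hl
    have h₂ := hC₂ l hl
    rw [hsum] at h₂
    have hap : a₁ p = a p := by simp [a₁, hχp]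
    rw [hap] at h₁
    rw [hsplit, Finset.sum_insert hp, add_mul, mul_add, add_sub_add_comm]
    exact (norm_add_le _ _).trans (add_le_add h₁ h₂)

/-- Stationary phase on an open subset of `ℝⁿ`. -/
theorem isBigO_integral_sub_sum {U : Set (Model n)} (hU : IsOpen U) {S : Model n → ℝ}
    (hS : ContDiffOn ℝ ∞ S U) (F : Finset (Model n)) (hFU : ∀ q ∈ F, q ∈ U)
    (hF : ∀ q ∈ F, fderiv ℝ S q = 0 ∧ (hessian S q).det ≠ 0)
    {a : Model n → ℂ} (ha : ContDiff ℝ ∞ a) (hac : HasCompactSupport a) (haU : tsupport a ⊆ U)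
    (hcrit : ∀ y ∈ tsupport a, fderiv ℝ S y = 0 → y ∈ F) :
    (fun ħ : ℝ => (∫ y, a y * cexp (I / ħ * S y)) - (((2 * Real.pi * ħ) ^ ((n : ℝ) / 2) : ℝ) : ℂ) *
        ∑ q ∈ F, a q * (cexp (I / ħ * S q) * hessianFactor (hessian S q)))
      =O[𝓝[>] 0] fun ħ : ℝ => ħ ^ (1 + (n : ℝ) / 2) := by
  have hK : IsClosed (tsupport a ∪ (F : Set (Model n))) :=
    (isClosed_tsupport a).union F.finite_toSet.isClosed
  have hKU : tsupport a ∪ (F : Set (Model n)) ⊆ U := union_subset haU fun q hq => hFU q hq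
  -- Multiplication by `f` extends `S` smoothly from `U` to `ℝⁿ` without changing its germs on
  -- `tsupport a` and at the points of `F`; the latter need not lie in `tsupport a`, yet their
  -- Hessians must agree.
  obtain ⟨f, hf0, hf1, -⟩ := exists_contMDiffMap_zero_one_nhds_of_isClosed
    (n := ⊤) 𝓘(ℝ, Model n) hU.isClosed_compl hK
    (by rw [disjoint_compl_left_iff_subset]; exact hKU)
  have hfs : ContDiff ℝ ∞ f := f.contMDiff.contDiff
  let T : Model n → ℝ := fun y => f y * S y
  have hTS : ∀ y ∈ tsupport a ∪ (F : Set (Model n)), T =ᶠ[𝓝 y] S := fun y hy => by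
    filter_upwards [eventually_nhdsSet_iff_forall.1 hf1 y hy] with z hz
    simp [T, hz]
  have hT : ContDiff ℝ ∞ T := by
    refine contDiff_of_tsupport fun y hy => ?_
    by_cases hyU : y ∈ U
    · exact hfs.contDiffAt.mul (hS.contDiffAt (hU.mem_nhds hyU))
    · refine absurd hy ?_
      rw [notMem_tsupport_iff_eventuallyEq]
      filter_upwards [eventually_nhdsSet_iff_forall.1 hf0 y hyU] with z hz
      simp [T, hz]
  have hTh : ∀ q ∈ F, hessian T q = hessian S q := fun q hq => by
    ext i j
    have h1 := (hTS q (Or.inr hq)).fderiv (𝕜 := ℝ)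
    rw [hessian_apply, hessian_apply, h1.fderiv_eq]
  obtain ⟨C, hC⟩ := exists_norm_integral_sub_sum_le hT F (fun q hq => by
      rw [(hTS q (Or.inr hq)).fderiv_eq, hTh q hq]
      exact hF q hq) ha hac
    fun y hy h0 => hcrit y hy (by rwa [(hTS y (Or.inl hy)).fderiv_eq] at h0)
  refine Asymptotics.IsBigO.of_bound C ?_
  have hsmall : ∀ᶠ ħ : ℝ in 𝓝[>] 0, ħ ∈ Ioc (0 : ℝ) 1 := Ioc_mem_nhdsGT one_pos
  filter_upwards [hsmall] with ħ hħ
  have h1 := hC ħ⁻¹ ((one_le_inv₀ hħ.1).2 hħ.2)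
  have hI : ∀ x : ℝ, I * ((ħ⁻¹ : ℝ) : ℂ) * x = I / ħ * x := fun x => by
    push_cast; rw [div_eq_mul_inv]
  rw [Real.norm_eq_abs, abs_of_pos (Real.rpow_pos_of_pos hħ.1 _)]
  rw [Real.inv_rpow hħ.1.le, Real.rpow_neg hħ.1.le, inv_inv, div_inv_eq_mul] at h1
  refine le_trans (le_of_eq ?_) h1
  congr 2
  · congr 1 with y
    by_cases hy : y ∈ tsupport a
    · rw [hI, (hTS y (Or.inl hy)).self_of_nhds]
    · simp [image_eq_zero_of_notMem_tsupport hy]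
  · congr 1
    refine Finset.sum_congr rfl fun q hq => ?_
    rw [criticalTerm, hI, hTh q hq, (hTS q (Or.inr hq)).self_of_nhds]

end Euclidean

/-! ### Transformation of Hessians and top forms under coordinate changes. -/

section ChainRule

variable {n : ℕ}

/-- The second derivative of `f ∘ g` at a point over a critical point of `f`. -/
theorem fderiv_fderiv_comp_apply {f : Model n → ℝ} {g : Model n → Model n} {y : Model n}
    (hf : ContDiffAt ℝ ∞ f (g y)) (hg : ContDiffAt ℝ ∞ g y) (h0 : fderiv ℝ f (g y) = 0)
    (v w : Model n) :
    fderiv ℝ (fderiv ℝ (f ∘ g)) y v w =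
      fderiv ℝ (fderiv ℝ f) (g y) (fderiv ℝ g y v) (fderiv ℝ g y w) := by
  have hev : ∀ᶠ z in 𝓝 y, fderiv ℝ (f ∘ g) z = (fderiv ℝ f (g z)).comp (fderiv ℝ g z) := by
    have h1 : ∀ᶠ z in 𝓝 (g y), ContDiffAt ℝ 1 f z :=
      (hf.of_le (by simp)).eventually (by simp)
    have h2 : ∀ᶠ z in 𝓝 y, ContDiffAt ℝ 1 g z := (hg.of_le (by simp)).eventually (by simp)
    filter_upwards [hg.continuousAt.eventually h1, h2] with z hz1 hz2
    exact fderiv_comp z (hz1.differentiableAt (by simp)) (hz2.differentiableAt (by simp))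
  have hfd : HasFDerivAt (fderiv ℝ f) (fderiv ℝ (fderiv ℝ f) (g y)) (g y) :=
    ((hf.fderiv_right (m := ∞) (by simp)).differentiableAt (by simp)).hasFDerivAt
  have hgd : HasFDerivAt (fderiv ℝ g) (fderiv ℝ (fderiv ℝ g) y) y :=
    ((hg.fderiv_right (m := ∞) (by simp)).differentiableAt (by simp)).hasFDerivAt
  have hg' : HasFDerivAt g (fderiv ℝ g y) y := (hg.differentiableAt (by simp)).hasFDerivAt
  have h3 := (hfd.comp y hg').clm_comp hgd
  rw [EventuallyEq.fderiv_eq hev]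
  have h4 : fderiv ℝ (fun z => (fderiv ℝ f (g z)).comp (fderiv ℝ g z)) y = _ := h3.fderiv
  rw [h4]
  -- The term containing the second derivative of `g` is composed with the gradient of `f`, which is
  -- zero here; hence Hessians at critical points change by congruence.
  simp [h0]

theorem hessian_comp {f : Model n → ℝ} {g : Model n → Model n} {y : Model n}
    (hf : ContDiffAt ℝ ∞ f (g y)) (hg : ContDiffAt ℝ ∞ g y) (h0 : fderiv ℝ f (g y) = 0) :
    ∃ J : Matrix (Fin n) (Fin n) ℝ, J.det = (fderiv ℝ g y).det ∧
      hessian (f ∘ g) y = J.transpose * hessian f (g y) * J := by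
  let b := (EuclideanSpace.basisFun (Fin n) ℝ).toBasis
  let J := LinearMap.toMatrix b b (fderiv ℝ g y : Model n →ₗ[ℝ] Model n)
  have hJ : ∀ i, (fderiv ℝ g y (EuclideanSpace.single i 1)).ofLp = fun k => J k i := fun i => by
    funext k
    simp [J, b, LinearMap.toMatrix_apply]
  refine ⟨J, LinearMap.det_toMatrix b _, ?_⟩
  ext i j
  rw [hessian_apply, fderiv_fderiv_comp_apply hf hg h0, fderiv_fderiv_apply_eq_dotProduct, hJ, hJ,
    Matrix.mul_assoc, Matrix.mul_apply]
  rfl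

/-- The square root of `|det (JᵀHJ)|` is `|det J| |det H|^{1/2}`, which is what the transformation
of a density compensates; the signature is unchanged by Sylvester's law. -/
theorem hessianFactor_transpose_mul_mul (H J : Matrix (Fin n) (Fin n) ℝ) (hJ : J.det ≠ 0) :
    hessianFactor (J.transpose * H * J) * |J.det| = hessianFactor H := by
  have h1 : Real.sqrt |(J.transpose * H * J).det| = |J.det| * Real.sqrt |H.det| := by
    rw [Matrix.det_mul, Matrix.det_mul, Matrix.det_transpose, abs_mul, abs_mul,
      mul_right_comm, Real.sqrt_mul (by positivity), Real.sqrt_mul_self (abs_nonneg _)]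
  have h2 : ((|J.det| : ℝ) : ℂ) ≠ 0 := ofReal_ne_zero.2 (abs_ne_zero.2 hJ)
  rw [hessianFactor, hessianFactor, signature_transpose_mul_mul H J hJ, h1, ofReal_mul]
  field_simp

theorem det_clm_comp (A B : Model n →L[ℝ] Model n) : (A.comp B).det = A.det * B.det :=
  LinearMap.det_comp _ _

/-- Top degree alternating forms are multiples of the determinant of a basis. -/
theorem alternatingMap_apply_comp {V : Type*} [AddCommGroup V] [Module ℝ V]
    (b : Module.Basis (Fin n) ℝ V) (f : V [⋀^Fin n]→ₗ[ℝ] ℝ) (A : V →ₗ[ℝ] V) (v : Fin n → V) :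
    f (fun i => A (v i)) = LinearMap.det A * f v := by
  have h := f.eq_smul_basis_det b
  rw [h]
  have := b.det_comp A v
  simp only [AlternatingMap.smul_apply, smul_eq_mul]
  change f b * b.det (A ∘ v) = _
  rw [this]
  ring

end ChainRule

/-! ### Chart independence of critical points, Hessians and local terms. -/

section Charts

variable {n : ℕ} {X : Type*} [TopologicalSpace X] {e e' : OpenPartialHomeomorph X (Model n)} {p : X}

theorem eventually_symm_eq (hp : p ∈ e.source) (hp' : p ∈ e'.source) :
    ∀ᶠ y in 𝓝 (e' p), e'.symm y = e.symm ((e ∘ e'.symm) y) := by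
  have h1 : ContinuousAt e'.symm (e' p) := e'.continuousAt_symm (e'.map_source hp')
  have h2 : ∀ᶠ y in 𝓝 (e' p), e'.symm y ∈ e.source :=
    h1.eventually (e.open_source.mem_nhds (by rwa [e'.left_inv hp']))
  filter_upwards [h2] with y hy
  exact (e.left_inv hy).symm

theorem phaseTerm_eq (S : X → ℝ) (e : OpenPartialHomeomorph X (Model n)) (p : X) (m ħ : ℝ) :
    phaseTerm S e p m ħ = cexp (I / ħ * S p) * hessianFactor (hessianMatrix S e p) * m := rfl

variable [ChartedSpace (Model n) X] {S : X → ℝ}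

theorem mdifferentiable_of_mem_maximalAtlas {e : OpenPartialHomeomorph X (Model n)}
    (he : e ∈ IsManifold.maximalAtlas (𝓡 n) ∞ X) : e.MDifferentiable (𝓡 n) (𝓡 n) :=
  ⟨(contMDiffOn_of_mem_maximalAtlas he).mdifferentiableOn (by simp),
    (contMDiffOn_symm_of_mem_maximalAtlas he).mdifferentiableOn (by simp)⟩

theorem contDiffOn_comp_symm (he : e ∈ IsManifold.maximalAtlas (𝓡 n) ∞ X)
    (hS : ContMDiff (𝓡 n) 𝓘(ℝ, ℝ) ∞ S) : ContDiffOn ℝ ∞ (S ∘ e.symm) e.target :=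
  contMDiffOn_iff_contDiffOn.1 (hS.comp_contMDiffOn (contMDiffOn_symm_of_mem_maximalAtlas he))

/-- The differential of the inverse chart is surjective, so vanishing of the coordinate gradient
forces vanishing of the differential on the manifold. -/
theorem mem_crit_iff (he : e ∈ IsManifold.maximalAtlas (𝓡 n) ∞ X)
    (hS : ContMDiff (𝓡 n) 𝓘(ℝ, ℝ) ∞ S) (hp : p ∈ e.source) :
    p ∈ crit n S ↔ fderiv ℝ (S ∘ e.symm) (e p) = 0 := by
  have hm := mdifferentiable_of_mem_maximalAtlas he
  have ht := e.map_source hp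
  have hSd : MDifferentiable (𝓡 n) 𝓘(ℝ, ℝ) S := hS.mdifferentiable (by simp)
  have h1 : mfderiv (𝓡 n) 𝓘(ℝ, ℝ) (S ∘ e.symm) (e p) =
      (mfderiv (𝓡 n) 𝓘(ℝ, ℝ) S (e.symm (e p))).comp (mfderiv (𝓡 n) (𝓡 n) e.symm (e p)) :=
    mfderiv_comp _ (hSd _) (hm.mdifferentiableAt_symm ht)
  have h2 : fderiv ℝ (S ∘ e.symm) (e p) =
      (mfderiv (𝓡 n) 𝓘(ℝ, ℝ) S (e.symm (e p))).comp (mfderiv (𝓡 n) (𝓡 n) e.symm (e p)) := by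
    rw [← h1, mfderiv_eq_fderiv]
  have h3 : p ∈ crit n S ↔ mfderiv (𝓡 n) 𝓘(ℝ, ℝ) S (e.symm (e p)) = 0 := by
    rw [e.left_inv hp]; rfl
  rw [h3, h2]
  constructor
  · intro h; rw [h]; rfl
  · intro h
    have hsurj := hm.symm.mfderiv_surjective (x := e p) ht
    refine ContinuousLinearMap.ext fun v => ?_
    obtain ⟨w, rfl⟩ := hsurj v
    exact congrArg (fun L : Model n →L[ℝ] ℝ => L w) h

theorem contDiffAt_transition (he : e ∈ IsManifold.maximalAtlas (𝓡 n) ∞ X)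
    (he' : e' ∈ IsManifold.maximalAtlas (𝓡 n) ∞ X) (hp : p ∈ e.source) (hp' : p ∈ e'.source) :
    ContDiffAt ℝ ∞ (e ∘ e'.symm) (e' p) := by
  refine contMDiffAt_iff_contDiffAt.1 (ContMDiffAt.comp (I' := 𝓡 n) (e' p) ?_
    (contMDiffAt_symm_of_mem_maximalAtlas he' (e'.map_source hp')))
  rw [e'.left_inv hp']
  exact contMDiffAt_of_mem_maximalAtlas he hp

/-- The two transition maps are mutually inverse near the point, so their Jacobian determinants
multiply to `1`. -/
theorem det_fderiv_transition_ne_zero (he : e ∈ IsManifold.maximalAtlas (𝓡 n) ∞ X)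
    (he' : e' ∈ IsManifold.maximalAtlas (𝓡 n) ∞ X) (hp : p ∈ e.source) (hp' : p ∈ e'.source) :
    (fderiv ℝ (e ∘ e'.symm) (e' p)).det ≠ 0 := by
  have hg := (contDiffAt_transition he he' hp hp').differentiableAt (by simp)
  have hg' := (contDiffAt_transition he' he hp' hp).differentiableAt (by simp)
  have hpt : (e ∘ e'.symm) (e' p) = e p := by simp [e'.left_inv hp']
  have hid : ((e' ∘ e.symm) ∘ (e ∘ e'.symm)) =ᶠ[𝓝 (e' p)] id := by
    filter_upwards [eventually_symm_eq hp hp', e'.open_target.mem_nhds (e'.map_source hp')]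
      with y hy hyt
    have : e (e'.symm y) = (e ∘ e'.symm) y := rfl
    simp only [Function.comp_apply, id] at hy ⊢
    rw [← hy, e'.right_inv hyt]
  have hcomp := fderiv_comp (e' p) (hpt ▸ hg') hg
  rw [hid.fderiv_eq, fderiv_id] at hcomp
  intro h0
  have h1 := congrArg ContinuousLinearMap.det hcomp
  rw [det_clm_comp, h0, mul_zero] at h1
  simp [ContinuousLinearMap.det] at h1

theorem hessianMatrix_eq_transpose_mul_mul (he : e ∈ IsManifold.maximalAtlas (𝓡 n) ∞ X)
    (he' : e' ∈ IsManifold.maximalAtlas (𝓡 n) ∞ X) (hS : ContMDiff (𝓡 n) 𝓘(ℝ, ℝ) ∞ S)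
    (hp : p ∈ e.source) (hp' : p ∈ e'.source) (hcrit : p ∈ crit n S) :
    ∃ J : Matrix (Fin n) (Fin n) ℝ, J.det = (fderiv ℝ (e ∘ e'.symm) (e' p)).det ∧
      hessianMatrix S e' p = J.transpose * hessianMatrix S e p * J := by
  have hpt : (e ∘ e'.symm) (e' p) = e p := by simp [e'.left_inv hp']
  obtain ⟨J, hJ, hJH⟩ := hessian_comp (f := S ∘ e.symm) (g := e ∘ e'.symm) (y := e' p)
    (by rw [hpt]; exact (contDiffOn_comp_symm he hS).contDiffAt
          (e.open_target.mem_nhds (e.map_source hp)))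
    (contDiffAt_transition he he' hp hp')
    (by rw [hpt]; exact (mem_crit_iff he hS hp).1 hcrit)
  refine ⟨J, hJ, ?_⟩
  rw [hpt] at hJH
  have hev : (S ∘ e'.symm) =ᶠ[𝓝 (e' p)] ((S ∘ e.symm) ∘ (e ∘ e'.symm)) := by
    filter_upwards [eventually_symm_eq hp hp'] with y hy
    simp only [Function.comp_apply] at hy ⊢
    rw [← hy]
  have h1 : hessian (S ∘ e'.symm) (e' p) = hessian ((S ∘ e.symm) ∘ (e ∘ e'.symm)) (e' p) := by
    ext i j
    rw [hessian_apply, hessian_apply, (hev.fderiv (𝕜 := ℝ)).fderiv_eq]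
  exact h1.trans hJH

/-- The coordinate frame of one chart in terms of that of another. -/
theorem exists_coordFrame_eq (he : e ∈ IsManifold.maximalAtlas (𝓡 n) ∞ X)
    (he' : e' ∈ IsManifold.maximalAtlas (𝓡 n) ∞ X) (hp : p ∈ e.source) (hp' : p ∈ e'.source) :
    ∃ A : Model n →ₗ[ℝ] Model n, LinearMap.det A = (fderiv ℝ (e ∘ e'.symm) (e' p)).det ∧
      ∀ i, (coordFrame e' (e' p) i : Model n) = A (coordFrame e (e p) i : Model n) := by
  have hm := mdifferentiable_of_mem_maximalAtlas he
  have hpt : (e ∘ e'.symm) (e' p) = e p := by simp [e'.left_inv hp']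
  let L : Model n →L[ℝ] Model n := mfderiv (𝓡 n) (𝓡 n) e.symm (e p)
  let L' : Model n →L[ℝ] Model n := mfderiv (𝓡 n) (𝓡 n) e p
  let J : Model n →L[ℝ] Model n := fderiv ℝ (e ∘ e'.symm) (e' p)
  have hLL' : L.comp L' = ContinuousLinearMap.id ℝ (Model n) := hm.symm_comp_deriv hp
  have hL'L : L'.comp L = ContinuousLinearMap.id ℝ (Model n) := by
    have := hm.comp_symm_deriv (e.map_source hp)
    rw [e.left_inv hp] at this
    exact this
  have hchain : (mfderiv (𝓡 n) (𝓡 n) e'.symm (e' p) : Model n →L[ℝ] Model n) = L.comp J := by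
    have h1 : mfderiv (𝓡 n) (𝓡 n) e'.symm (e' p) =
        mfderiv (𝓡 n) (𝓡 n) (e.symm ∘ (e ∘ e'.symm)) (e' p) :=
      EventuallyEq.mfderiv_eq (eventually_symm_eq hp hp')
    have h2 : mfderiv (𝓡 n) (𝓡 n) (e.symm ∘ (e ∘ e'.symm)) (e' p) = _ :=
      mfderiv_comp (I' := 𝓡 n) (e' p)
        (by rw [hpt]; exact hm.mdifferentiableAt_symm (e.map_source hp))
        ((contDiffAt_transition he he' hp hp').differentiableAt (by simp)).mdifferentiableAt
    rw [h1, h2, mfderiv_eq_fderiv]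
    have h3 : ∀ q, q = e p → (mfderiv (𝓡 n) (𝓡 n) e.symm q : Model n →L[ℝ] Model n) = L := by
      rintro q rfl; rfl
    exact congrArg (fun K : Model n →L[ℝ] Model n => K.comp J) (h3 _ hpt)
  have hLL'v : ∀ v, L' (L v) = v := fun v => congrArg (fun K : Model n →L[ℝ] Model n => K v) hL'L
  -- The frame of `e` is the image of the standard basis under `L`, that of `e'` under `L ∘ J`; the
  -- passage between them is the conjugate `L J L⁻¹`, whose determinant is that of `J`.
  refine ⟨(L.comp (J.comp L') : Model n →L[ℝ] Model n), ?_, fun i => ?_⟩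
  · have h1 : L.det * L'.det = 1 := by
      rw [← det_clm_comp, hLL']
      simp [ContinuousLinearMap.det]
    change (L.comp (J.comp L')).det = J.det
    rw [det_clm_comp, det_clm_comp]
    linear_combination J.det * h1
  · change (mfderiv (𝓡 n) (𝓡 n) e'.symm (e' p) : Model n →L[ℝ] Model n)
      (EuclideanSpace.single i 1) = L (J (L' (L (EuclideanSpace.single i 1))))
    rw [hchain, hLL'v]
    rfl

theorem SmoothDensity.coeff_eq (μ : SmoothDensity n X)
    (he : e ∈ IsManifold.maximalAtlas (𝓡 n) ∞ X) (he' : e' ∈ IsManifold.maximalAtlas (𝓡 n) ∞ X)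
    (hp : p ∈ e.source) (hp' : p ∈ e'.source) :
    μ.coeff e' (e' p) = |(fderiv ℝ (e ∘ e'.symm) (e' p)).det| * μ.coeff e (e p) := by
  obtain ⟨A, hA, hAf⟩ := exists_coordFrame_eq he he' hp hp'
  -- Tangent spaces are definitionally the model space. Forgetting their dependence on the base
  -- point allows `e.symm (e p)` to be rewritten to `p`.
  let m : X → (Fin n → Model n) → ℝ := fun x v => μ.toFun x v
  have h1 : μ.coeff e' (e' p) = m p (fun i => A (coordFrame e (e p) i : Model n)) := by
    change m (e'.symm (e' p)) (fun i => (coordFrame e' (e' p) i : Model n)) = _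
    rw [e'.left_inv hp']
    exact congrArg (m p) (funext hAf)
  have h2 : μ.coeff e (e p) = m p (fun i => (coordFrame e (e p) i : Model n)) := by
    change m (e.symm (e p)) (fun i => (coordFrame e (e p) i : Model n)) = _
    rw [e.left_inv hp]
  rw [h1, h2, ← hA]
  exact μ.map_comp p A _

theorem SmoothTopForm.coeff_eq (η : SmoothTopForm n X)
    (he : e ∈ IsManifold.maximalAtlas (𝓡 n) ∞ X) (he' : e' ∈ IsManifold.maximalAtlas (𝓡 n) ∞ X)
    (hp : p ∈ e.source) (hp' : p ∈ e'.source) :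
    η.coeff e' (e' p) = (fderiv ℝ (e ∘ e'.symm) (e' p)).det * η.coeff e (e p) := by
  obtain ⟨A, hA, hAf⟩ := exists_coordFrame_eq he he' hp hp'
  let m : X → Model n [⋀^Fin n]→ₗ[ℝ] ℝ := fun x => η.toFun x
  have h1 : η.coeff e' (e' p) = m p (fun i => A (coordFrame e (e p) i : Model n)) := by
    change m (e'.symm (e' p)) (fun i => (coordFrame e' (e' p) i : Model n)) = _
    rw [e'.left_inv hp']
    exact congrArg (m p) (funext hAf)
  have h2 : η.coeff e (e p) = m p (fun i => (coordFrame e (e p) i : Model n)) := by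
    change m (e.symm (e p)) (fun i => (coordFrame e (e p) i : Model n)) = _
    rw [e.left_inv hp]
  rw [h1, h2, ← hA]
  exact alternatingMap_apply_comp (EuclideanSpace.basisFun (Fin n) ℝ).toBasis (m p) A _

/-- The terms of the stationary phase formula do not depend on the chart. -/
theorem phaseTerm_eq_of_coeff_eq (he : e ∈ IsManifold.maximalAtlas (𝓡 n) ∞ X)
    (he' : e' ∈ IsManifold.maximalAtlas (𝓡 n) ∞ X) (hS : ContMDiff (𝓡 n) 𝓘(ℝ, ℝ) ∞ S)
    (hp : p ∈ e.source) (hp' : p ∈ e'.source) (hcrit : p ∈ crit n S) {m m' : ℝ}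
    (hm : m' = |(fderiv ℝ (e ∘ e'.symm) (e' p)).det| * m) (ħ : ℝ) :
    phaseTerm S e' p m' ħ = phaseTerm S e p m ħ := by
  obtain ⟨J, hJ, hJH⟩ := hessianMatrix_eq_transpose_mul_mul he he' hS hp hp' hcrit
  have hJ0 : J.det ≠ 0 := hJ ▸ det_fderiv_transition_ne_zero he he' hp hp'
  rw [phaseTerm_eq, phaseTerm_eq, hJH, hm, ← hJ,
    ← hessianFactor_transpose_mul_mul (hessianMatrix S e p) J hJ0]
  push_cast
  ring

/-- Nondegeneracy, known in one chart, passes to every other by congruence with an invertible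
Jacobian. -/
theorem det_hessianMatrix_ne_zero (he : e ∈ IsManifold.maximalAtlas (𝓡 n) ∞ X)
    (hS : ContMDiff (𝓡 n) 𝓘(ℝ, ℝ) ∞ S) (hp : p ∈ e.source) (hcrit : p ∈ crit n S)
    (hnd : HasNondegenerateHessian n S p) : (hessianMatrix S e p).det ≠ 0 := by
  obtain ⟨e₀, he₀, hp₀, hdet⟩ := hnd
  obtain ⟨J, hJ, hJH⟩ := hessianMatrix_eq_transpose_mul_mul he₀ he hS hp₀ hp hcrit
  have hJ0 : J.det ≠ 0 := hJ ▸ det_fderiv_transition_ne_zero he₀ he hp₀ hp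
  rw [hJH, Matrix.det_mul, Matrix.det_mul, Matrix.det_transpose]
  exact mul_ne_zero (mul_ne_zero hJ0 hdet) hJ0

end Charts

/-! ### Gluing the charts with a partition of unity. -/

section Global

variable {n : ℕ} {X : Type*} [TopologicalSpace X] [CompactSpace X] [ChartedSpace (Model n) X]
  {e : OpenPartialHomeomorph X (Model n)} {S : X → ℝ}

/-- The representation in a chart of a compactly supported smooth amplitude. -/
theorem exists_amplitude_in_chart (he : e ∈ IsManifold.maximalAtlas (𝓡 n) ∞ X) {ψ : X → ℝ}
    (hψ : ContMDiff (𝓡 n) 𝓘(ℝ, ℝ) ∞ ψ) (hψe : tsupport ψ ⊆ e.source) {ρ : Model n → ℝ}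
    (hρ : ContDiffOn ℝ ∞ ρ e.target) :
    ∃ a : Model n → ℂ, ContDiff ℝ ∞ a ∧ HasCompactSupport a ∧ tsupport a ⊆ e.target ∧
      (∀ y ∈ e.target, a y = (ψ (e.symm y) * ρ y : ℝ)) ∧ ∀ y ∉ e.target, a y = 0 := by
  classical
  let a₀ : Model n → ℝ := fun y => ψ (e.symm y) * ρ y
  let a : Model n → ℂ := indicator e.target fun y => (a₀ y : ℂ)
  -- Compactness keeps the support of the amplitude away from the boundary of `e.target`, so
  -- extension by zero is smooth.
  have hK : IsCompact (e '' tsupport ψ) :=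
    (isClosed_tsupport ψ).isCompact.image_of_continuousOn (e.continuousOn.mono hψe)
  have hKt : e '' tsupport ψ ⊆ e.target := by
    rintro _ ⟨x, hx, rfl⟩
    exact e.map_source (hψe hx)
  have hsupp : Function.support a ⊆ e '' tsupport ψ := fun y hy => by
    have hyt : y ∈ e.target := by
      by_contra h
      exact hy (indicator_of_notMem h _)
    refine ⟨e.symm y, subset_tsupport ψ fun h0 => hy ?_, e.right_inv hyt⟩
    simp [a, a₀, hyt, h0]
  have hts : tsupport a ⊆ e '' tsupport ψ := closure_minimal hsupp hK.isClosed
  refine ⟨a, contDiff_of_tsupport fun y hy => ?_, hK.of_isClosed_subset (isClosed_tsupport a) hts,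
    hts.trans hKt, fun y hy => by simp [a, a₀, hy], fun y hy => by simp [a, hy]⟩
  have hyt := e.open_target.mem_nhds (hKt (hts hy))
  have h1 : ContDiffAt ℝ ∞ a₀ y :=
    ((contDiffOn_comp_symm he hψ).mul hρ).contDiffAt hyt
  refine (ofRealCLM.contDiff.contDiffAt.comp y h1).congr_of_eventuallyEq ?_
  filter_upwards [hyt] with z hz
  simp [a, hz]

/-- The stationary phase formula for an amplitude supported in the domain of a chart. -/
theorem isBigO_setIntegral_sub_sum (he : e ∈ IsManifold.maximalAtlas (𝓡 n) ∞ X)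
    (hS : ContMDiff (𝓡 n) 𝓘(ℝ, ℝ) ∞ S) (hfin : (crit n S).Finite)
    (hnd : ∀ p ∈ crit n S, HasNondegenerateHessian n S p) {ψ : X → ℝ}
    (hψ : ContMDiff (𝓡 n) 𝓘(ℝ, ℝ) ∞ ψ) (hψe : tsupport ψ ⊆ e.source) {ρ : Model n → ℝ}
    (hρ : ContDiffOn ℝ ∞ ρ e.target) :
    (fun ħ : ℝ => (∫ y in e.target,
        (ψ (e.symm y) : ℂ) * cexp (I / ħ * S (e.symm y)) * (ρ y : ℂ)) -
          (((2 * Real.pi * ħ) ^ ((n : ℝ) / 2) : ℝ) : ℂ) *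
            ∑ p ∈ hfin.toFinset, (ψ p : ℂ) * phaseTerm S e p (ρ (e p)) ħ)
      =O[𝓝[>] 0] fun ħ : ℝ => ħ ^ (1 + (n : ℝ) / 2) := by
  classical
  obtain ⟨a, ha, hac, hat, haeq, ha0⟩ := exists_amplitude_in_chart he hψ hψe hρ
  let P := hfin.toFinset.filter (· ∈ e.source)
  have hP : ∀ p, p ∈ P ↔ p ∈ crit n S ∧ p ∈ e.source := fun p => by simp [P]
  have hinj : Set.InjOn e P := fun p hp q hq h =>
    e.injOn ((hP p).1 hp).2 ((hP q).1 hq).2 h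
  have key := isBigO_integral_sub_sum e.open_target (contDiffOn_comp_symm he hS) (P.image e)
    (fun q hq => by
      obtain ⟨p, hp, rfl⟩ := Finset.mem_image.1 hq
      exact e.map_source ((hP p).1 hp).2)
    (fun q hq => by
      obtain ⟨p, hp, rfl⟩ := Finset.mem_image.1 hq
      obtain ⟨hc, hs⟩ := (hP p).1 hp
      exact ⟨(mem_crit_iff he hS hs).1 hc, det_hessianMatrix_ne_zero he hS hs hc (hnd p hc)⟩)
    ha hac hat
    (fun y hy h0 => by
      have hyt := hat hy
      refine Finset.mem_image.2 ⟨e.symm y, (hP _).2 ⟨?_, e.map_target hyt⟩, e.right_inv hyt⟩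
      rw [mem_crit_iff he hS (e.map_target hyt), e.right_inv hyt]
      exact h0)
  refine key.congr_left fun ħ => ?_
  congr 1
  · rw [← integral_indicator e.open_target.measurableSet]
    congr 1 with y
    by_cases hy : y ∈ e.target
    · rw [indicator_of_mem hy, haeq y hy]
      push_cast
      simp only [Function.comp_apply]
      ring
    · rw [indicator_of_notMem hy, ha0 y hy, zero_mul]
  · congr 1
    rw [Finset.sum_image hinj, ← Finset.sum_filter_add_sum_filter_not hfin.toFinset (· ∈ e.source)]
    -- Outside the chart domain `phaseTerm` has no meaning, but `ψ` vanishes there. Keeping all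
    -- critical points in the sum lets the charts be added up later.
    have hzero : ∑ p ∈ hfin.toFinset with p ∉ e.source,
        (ψ p : ℂ) * phaseTerm S e p (ρ (e p)) ħ = 0 := by
      refine Finset.sum_eq_zero fun p hp => ?_
      have : ψ p = 0 := image_eq_zero_of_notMem_tsupport
        fun h => (Finset.mem_filter.1 hp).2 (hψe h)
      simp [this]
    rw [hzero, add_zero]
    refine Finset.sum_congr rfl fun p hp => ?_
    have hs := ((hP p).1 hp).2
    rw [haeq _ (e.map_source hs), phaseTerm_eq]
    simp only [Function.comp_apply, e.left_inv hs]
    change _ * (_ * hessianFactor (hessianMatrix S e p)) = _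
    push_cast
    ring

variable [T2Space X] [IsManifold (𝓡 n) ∞ X]

/-- The stationary phase formula for an object with smooth coefficients `ρ` in the charts, whose
contributions at the critical points do not depend on the chart. -/
theorem isBigO_chartIntegral_sub_sum (hS : ContMDiff (𝓡 n) 𝓘(ℝ, ℝ) ∞ S)
    (hfin : (crit n S).Finite) (hnd : ∀ p ∈ crit n S, HasNondegenerateHessian n S p)
    (c : X → OpenPartialHomeomorph X (Model n)) (hc : ∀ x, x ∈ (c x).source)
    (hcm : ∀ x, c x ∈ IsManifold.maximalAtlas (𝓡 n) ∞ X)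
    (ρ : OpenPartialHomeomorph X (Model n) → Model n → ℝ)
    (hρ : ∀ x, ContDiffOn ℝ ∞ (ρ (c x)) (c x).target) (t : X → ℝ → ℂ)
    (ht : ∀ x, ∀ p ∈ crit n S, p ∈ (c x).source →
      ∀ ħ, phaseTerm S (c x) p (ρ (c x) (c x p)) ħ = t p ħ) :
    (fun ħ : ℝ => chartIntegral c hc ρ (fun x => cexp (I / ħ * S x)) -
        (((2 * Real.pi * ħ) ^ ((n : ℝ) / 2) : ℝ) : ℂ) * ∑ p ∈ hfin.toFinset, t p ħ)
      =O[𝓝[>] 0] fun ħ : ℝ => ħ ^ (1 + (n : ℝ) / 2) := by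
  classical
  set ψ := partitionOfUnity c hc with hψ
  have hsub : ∀ x, tsupport (ψ x) ⊆ (c x).source := partitionOfUnity_isSubordinate c hc
  have hfinψ : {x | (Function.support (ψ x)).Nonempty}.Finite :=
    ψ.locallyFinite.finite_nonempty_of_compact
  let T : Finset X := hfinψ.toFinset
  have hT : ∀ x ∉ T, ∀ z, ψ x z = 0 := fun x hx z => by
    by_contra h
    exact hx (hfinψ.mem_toFinset.2 ⟨z, h⟩)
  have hsum := Asymptotics.IsBigO.sum (s := T) fun x _ => isBigO_setIntegral_sub_sum (hcm x) hS hfin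
    hnd (ψ := ψ x) (ψ x).contMDiff (hsub x) (hρ x)
  refine hsum.congr_left fun ħ => ?_
  rw [Finset.sum_apply, Finset.sum_sub_distrib, ← Finset.mul_sum, Finset.sum_comm]
  congr 1
  · rw [chartIntegral, finsum_eq_sum_of_support_subset]
    intro x hx
    by_contra hxT
    exact hx (by simp [← hψ, hT x hxT])
  · congr 1
    refine Finset.sum_congr rfl fun p hp => ?_
    have hpc : p ∈ crit n S := hfin.mem_toFinset.1 hp
    -- Once the local term is known to be the same in every chart, the weights `ψ x p` sum to `1` at
    -- each critical point.
    have hone : ∑ x ∈ T, ψ x p = 1 := by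
      refine ψ.sum_finsupport' p (mem_univ p) fun x hx => ?_
      rw [ψ.mem_finsupport] at hx
      exact hfinψ.mem_toFinset.2 ⟨p, hx⟩
    calc ∑ x ∈ T, (ψ x p : ℂ) * phaseTerm S (c x) p (ρ (c x) (c x p)) ħ
        = ∑ x ∈ T, (ψ x p : ℂ) * t p ħ := by
          refine Finset.sum_congr rfl fun x _ => ?_
          by_cases hs : p ∈ (c x).source
          · rw [ht x p hpc hs]
          · have : ψ x p = 0 := image_eq_zero_of_notMem_tsupport fun h => hs (hsub x h)
            simp [this]
      _ = t p ħ := by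
          rw [← Finset.sum_mul, ← ofReal_sum, hone, ofReal_one, one_mul]

end Global

end StationaryPhase

theorem mainTheorem4 {n : ℕ} {X : Type*} [TopologicalSpace X] [T2Space X] [CompactSpace X]
    [ChartedSpace (EuclideanSpace ℝ (Fin n)) X] [IsManifold (𝓡 n) ∞ X]
    (S : X → ℝ) (hS : ContMDiff (𝓡 n) 𝓘(ℝ, ℝ) ∞ S)
    (hfin : (StationaryPhase.crit n S).Finite)
    (hnd : ∀ p ∈ StationaryPhase.crit n S, StationaryPhase.HasNondegenerateHessian n S p) :
    (∀ (μ : StationaryPhase.SmoothDensity n X)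
      (c : X → OpenPartialHomeomorph X (EuclideanSpace ℝ (Fin n))),
      (∀ p ∈ StationaryPhase.crit n S,
        c p ∈ IsManifold.maximalAtlas (𝓡 n) ∞ X ∧ p ∈ (c p).source) →
      (fun ħ : ℝ => μ.integral (fun x => Complex.exp (Complex.I / ħ * S x)) -
          (((2 * Real.pi * ħ) ^ ((n : ℝ) / 2) : ℝ) : ℂ) *
            ∑ p ∈ hfin.toFinset, StationaryPhase.phaseTerm S (c p) p (μ.coeff (c p) (c p p)) ħ)
        =O[𝓝[>] 0] fun ħ : ℝ => ħ ^ (1 + (n : ℝ) / 2)) ∧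
    (∀ (o : StationaryPhase.OrientedAtlas n X) (η : StationaryPhase.SmoothTopForm n X)
      (c : X → OpenPartialHomeomorph X (EuclideanSpace ℝ (Fin n))),
      (∀ p ∈ StationaryPhase.crit n S, c p ∈ o.charts ∧ p ∈ (c p).source) →
      (fun ħ : ℝ => η.integral o (fun x => Complex.exp (Complex.I / ħ * S x)) -
          (((2 * Real.pi * ħ) ^ ((n : ℝ) / 2) : ℝ) : ℂ) *
            ∑ p ∈ hfin.toFinset, StationaryPhase.phaseTerm S (c p) p (η.coeff (c p) (c p p)) ħ)
        =O[𝓝[>] 0] fun ħ : ℝ => ħ ^ (1 + (n : ℝ) / 2)) := by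
  refine ⟨fun μ c hc => ?_, fun o η c hc => ?_⟩
  · have hchart : ∀ x : X, chartAt (EuclideanSpace ℝ (Fin n)) x ∈
        IsManifold.maximalAtlas (𝓡 n) ∞ X := fun x => IsManifold.chart_mem_maximalAtlas x
    exact StationaryPhase.isBigO_chartIntegral_sub_sum hS hfin hnd _ _ hchart μ.coeff
      (fun x => μ.smooth _ (hchart x))
      (fun p ħ => StationaryPhase.phaseTerm S (c p) p (μ.coeff (c p) (c p p)) ħ)
      fun x p hp hpx ħ => StationaryPhase.phaseTerm_eq_of_coeff_eq (hc p hp).1 (hchart x) hS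
        (hc p hp).2 hpx hp (μ.coeff_eq (hc p hp).1 (hchart x) (hc p hp).2 hpx) ħ
  · have hchart : ∀ x : X, (o.exists_mem_source x).choose ∈ o.charts :=
      fun x => (o.exists_mem_source x).choose_spec.1
    have hmax := fun x => o.subset_maximalAtlas (hchart x)
    refine StationaryPhase.isBigO_chartIntegral_sub_sum hS hfin hnd _ _ hmax η.coeff
      (fun x => η.smooth _ (hmax x))
      (fun p ħ => StationaryPhase.phaseTerm S (c p) p (η.coeff (c p) (c p p)) ħ)
      fun x p hp hpx ħ => ?_
    obtain ⟨hcp, hps⟩ := hc p hp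
    refine StationaryPhase.phaseTerm_eq_of_coeff_eq (o.subset_maximalAtlas hcp) (hmax x) hS
      hps hpx hp ?_ ħ
    -- Forms transform with `det J`, the local term needs `|det J|`; both agree because the two
    -- charts belong to the same oriented atlas.
    rw [abs_of_pos (o.sameOrientation _ (hchart x) _ hcp p ⟨hpx, hps⟩)]
    exact η.coeff_eq (o.subset_maximalAtlas hcp) (hmax x) hps hpx
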